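/- Let $n\ge 1$ and let $q:\mathbb R^n_x\times\mathbb R^n_\xi\to\mathbb C$ be a complex-valued quadratic form on the real vector space $\mathbb R^{2n}$ that is elliptic, i.e. $q(x,\xi)=0$ only for $(x,\xi)=(0,0)$. Let $\Sigma(q)=q(\mathbb R^n\times\mathbb R^n)\subset\mathbb C$ be its numerical range, and let $$B=\{u\in L^2(\mathbb R^n): x^\alpha D_x^\beta u\in L^2(\mathbb R^n)\ \text{whenever } |\alpha+\beta|\le 2\},$$ where $D_x=i^{-1}\partial_x$ in the sense of distributions. Let $q^w=q(x,\xi)^w: B\to L^2(\mathbb R^n)$ be the Weyl quantization of $q$, given on Schwartz functions by $$q(x,\xi)^w u(x)=\frac1{(2\pi)^n}\int_{\mathbb R^n}\Big(\int_{\mathbb R^n} e^{i(x-y)\cdot\xi}\,q\Big(\frac{x+y}{2},\xi\Big)u(y)\,dy\Big)\,d\xi$$ and on $B$ by extension in the sense of distributions, i.e. $\int (q^w u)\,\varphi\,dx=\int u\,(\check q^{\,w}\varphi)\,dx$ for all Schwartz functions $\varphi$, with $\check q(x,\xi)=q(x,-\xi)$. Then $q^w$ is a well-defined linear operator $B\to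 L^2(\mathbb R^n)$, and for every $z\in\mathbb C\setminus\Sigma(q)$ the operator $q^w-z:B\to L^2(\mathbb R^n)$ is bijective, its inverse is bounded on $L^2(\mathbb R^n)$, and $$\big\|(q^w-z)^{-1}\big\|\le\frac{1}{d(z,\Sigma(q))},$$ where $\|\cdot\|$ is the operator norm on $L^2(\mathbb R^n)$ and $d(z,\Sigma(q))$ is the distance from $z$ to $\Sigma(q)$. -/

import Mathlib

open MeasureTheory SchwartzMap
open scoped SchwartzMap LineDeriv

/-- The position space `ℝⁿ` with its Euclidean structure. -/
abbrev RSpace (n : ℕ) : Type := EuclideanSpace ℝ (Fin n)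

/-- The Hilbert space `L²(ℝⁿ)` of complex-valued functions, for the Lebesgue measure. -/
abbrev L2 (n : ℕ) : Type := Lp ℂ 2 (volume : Measure (RSpace n))

/-- Weyl quantization of the symbol `a(x, ξ)` applied to a Schwartz function `u`:
`a^w u (x) = (2π)⁻ⁿ ∫ (∫ e^{i (x - y)·ξ} a((x + y)/2, ξ) u(y) dy) dξ`. For polynomial symbols,
both integrals of the iterated integral converge absolutely
in this order. -/
noncomputable def weylSchwartz {n : ℕ} (a : RSpace n × RSpace n → ℂ) (u : 𝓢(RSpace n, ℂ))
    (x : RSpace n) : ℂ :=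
  ((2 * Real.pi : ℝ) : ℂ)⁻¹ ^ n *
    ∫ ξ : RSpace n, ∫ y : RSpace n,
      Complex.exp (Complex.I * ((inner ℝ (x - y) ξ : ℝ) : ℂ)) *
        a ((2⁻¹ : ℝ) • (x + y), ξ) * u y

/-- The operator `u ↦ x_{J 1} ⋯ x_{J k} ∂_{K 1} ⋯ ∂_{K l} u` on tempered distributions.
As `J` and `K` vary, these are the operators `x^α ∂^β` with `|α| = k` and `|β| = l`. -/
noncomputable def monomialOp {n k l : ℕ} (J : Fin k → Fin n) (K : Fin l → Fin n) :
    𝓢'(RSpace n, ℂ) →L[ℂ] 𝓢'(RSpace n, ℂ) :=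
  (TemperedDistribution.smulLeftCLM ℂ (fun x : RSpace n => ∏ i, ((x (J i) : ℝ) : ℂ))).comp
    (LineDeriv.iteratedLineDerivOpCLM ℂ 𝓢'(RSpace n, ℂ)
      (fun i => EuclideanSpace.single (K i) (1 : ℝ)))

/-- The space `B` of all `u ∈ L²(ℝⁿ)` such that `x^α D^β u ∈ L²(ℝⁿ)` whenever `|α + β| ≤ 2`, the
derivatives being taken in the sense of distributions. (The factor between `D^β` and `∂^β` is a
nonzero constant and does not matter.) -/
noncomputable def domainB (n : ℕ) : Submodule ℂ (L2 n) :=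
  ⨅ (k : ℕ) (l : ℕ) (_ : k + l ≤ 2) (J : Fin k → Fin n) (K : Fin l → Fin n),
    (LinearMap.range
        (Lp.toTemperedDistributionCLM ℂ (volume : Measure (RSpace n)) 2).toLinearMap).comap
      ((monomialOp J K).comp
        (Lp.toTemperedDistributionCLM ℂ (volume : Measure (RSpace n)) 2)).toLinearMap

/-- `A` is the operator `a^w : B → L²(ℝⁿ)`: it is given by the Weyl formula on Schwartz functions,
and on all of `B` it acts in the sense of distributions, `⟨a^w u, φ⟩ = ⟨u, (a^w)ᵗ φ⟩`, where the
transpose `(a^w)ᵗ` is the Weyl quantization of `(x, ξ) ↦ a(x, -ξ)`. -/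
structure IsWeylOperator {n : ℕ} (a : RSpace n × RSpace n → ℂ) (A : domainB n →ₗ[ℂ] L2 n) :
    Prop where
  on_schwartz : ∀ (φ : 𝓢(RSpace n, ℂ)) (u : domainB n),
    ((u : L2 n) : RSpace n → ℂ) =ᵐ[volume] φ →
      (A u : RSpace n → ℂ) =ᵐ[volume] weylSchwartz a φ
  weak : ∀ (u : domainB n) (φ : 𝓢(RSpace n, ℂ)),
    ∫ x, (A u : RSpace n → ℂ) x * φ x =
      ∫ x, ((u : L2 n) : RSpace n → ℂ) x * weylSchwartz (fun X => a (X.1, -X.2)) φ x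

/-- There is at most one such operator. -/
theorem IsWeylOperator.unique {n : ℕ} {a : RSpace n × RSpace n → ℂ} {A A' : domainB n →ₗ[ℂ] L2 n}
    (h : IsWeylOperator a A) (h' : IsWeylOperator a A') : A = A' := by
  ext1 u
  have key : Lp.toTemperedDistributionCLM ℂ (volume : Measure (RSpace n)) 2 (A u) =
      Lp.toTemperedDistributionCLM ℂ (volume : Measure (RSpace n)) 2 (A' u) := by
    ext φ
    have e := (h.weak u φ).trans (h'.weak u φ).symm
    simpa [Lp.toTemperedDistribution_apply, mul_comm] using e
  exact LinearMap.ker_eq_bot.mp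
    (Lp.ker_toTemperedDistributionCLM_eq_bot (F := ℂ) (μ := (volume : Measure (RSpace n)))
      (p := 2)) key

/-- The bounded operator `R` on `L²(ℝⁿ)` is the resolvent `(A - z)⁻¹` of the unbounded operator
`A` with domain `B`: a two-sided inverse of the bijection `A - z : B → L²(ℝⁿ)`. -/
structure IsResolventAt {n : ℕ} (A : domainB n →ₗ[ℂ] L2 n) (z : ℂ) (R : L2 n →L[ℂ] L2 n) :
    Prop where
  left_inv : ∀ u : domainB n, R (A u - z • (u : L2 n)) = u
  right_inv : ∀ f : L2 n, ∃ h : R f ∈ domainB n, A ⟨R f, h⟩ - z • R f = f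

/-- A complex-valued quadratic form `q` on `ℝⁿ × ℝⁿ` is elliptic if it vanishes only at `0`. -/
def IsElliptic {n : ℕ} (q : QuadraticMap ℝ (RSpace n × RSpace n) ℂ) : Prop :=
  ∀ X, q X = 0 → X = 0

/-- The numerical range `Σ(q)`: the set of all values of `q`. -/
def numRange {n : ℕ} (q : QuadraticMap ℝ (RSpace n × RSpace n) ℂ) : Set ℂ :=
  Set.range q

/-! Let `L a` run through the multiplications `x i` and the derivatives `D i`, symmetric on Schwartz
functions. Weyl's symmetric ordering gives `q^w = ∑ m a b L a L b`, where `m` is the symmetric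
matrix of `q` (`weylSchwartz_eq_quadOp`).

Numerical range. As `m` is symmetric, `⟨φ, q^w φ⟩` pairs `m` with the real part of the Gram matrix
of the `L a φ`. That real matrix is positive semidefinite, hence a sum of terms `v vᵀ`, so the
expectation is a sum of values of `q`. By Dines' theorem (`add_mem_range`) these values form a
convex cone, so the expectation lies in `Σ(q)` and `|⟨φ, (q^w - z) φ⟩| ≥ d ‖φ‖²` with `d = d(z,
Σ(q))` (`infDist_mul_norm_sq_le`).

Existence. This bound makes the Galerkin problems on the Hermite spaces solvable, with `‖u_N‖ ≤ ‖f‖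
/ d`. Since `Σ(q) ≠ ℂ`, ellipticity makes `Re (c q)` positive definite for some `c`
(`exists_coercive`). Hermite spaces are invariant under the harmonic oscillator `∑ L a ^ 2`, so `∑ L
a ^ 2 u_N` is an admissible test function; with first order commutators this bounds all `L a L b
u_N` uniformly (`exists_elliptic_estimate`). A weak limit then lies in `B`, solves the equation and
inherits the norm bound (`exists_solution`).

Uniqueness is by duality: the transposed symbol `q(x, -ξ)` is again elliptic with the same range, so
the Galerkin scheme applies to it, and the conjugate of a kernel element serves as its right-hand
side (`eq_zero_of_apply_eq_smul`). -/

namespace QuadraticMap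

/-! ### Convexity of the range of a planar quadratic map -/

section Range

variable {V : Type*} [AddCommGroup V] [Module ℝ V] (q : QuadraticMap ℝ V ℂ)

theorem map_smul_add_smul (a b : ℝ) (x y : V) :
    q (a • x + b • y) = (a ^ 2 : ℝ) * q x + (b ^ 2 : ℝ) * q y + (a * b : ℝ) * polar q x y := by
  rw [QuadraticMap.map_add q, QuadraticMap.map_smul, QuadraticMap.map_smul, polar_smul_left,
    polar_smul_right]
  simp only [Complex.real_smul, Complex.ofReal_mul, Complex.ofReal_pow]
  ring

/-- The range of a quadratic map into the plane is closed under nonnegative scaling. -/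
theorem smul_mem_range {t : ℝ} (ht : 0 ≤ t) {w : ℂ} (hw : w ∈ Set.range q) :
    (t : ℂ) * w ∈ Set.range q := by
  obtain ⟨x, rfl⟩ := hw
  refine ⟨Real.sqrt t • x, ?_⟩
  rw [QuadraticMap.map_smul, Real.mul_self_sqrt ht, Complex.real_smul]

/-- Dines' theorem: the range of a quadratic map into the plane is closed under addition. -/
theorem add_mem_range {w w' : ℂ} (hw : w ∈ Set.range q) (hw' : w' ∈ Set.range q) :
    w + w' ∈ Set.range q := by
  obtain ⟨x, rfl⟩ := hw
  obtain ⟨y, rfl⟩ := hw'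
  obtain ⟨α, β, γ, hne, hs, hrel⟩ : ∃ α β γ : ℝ, ¬ (α = 0 ∧ β = 0 ∧ γ = 0) ∧ 0 ≤ α + γ ∧
      (α : ℂ) * q x + (β : ℂ) * polar q x y + (γ : ℂ) * q y = 0 := by
    let F : (Fin 3 → ℝ) →ₗ[ℝ] ℂ := Fintype.linearCombination ℝ ![q x, polar q x y, q y]
    have hF : LinearMap.ker F ≠ ⊥ := LinearMap.ker_ne_bot_of_finrank_lt (by
      rw [Complex.finrank_real_complex, Module.finrank_fin_fun]; norm_num)
    obtain ⟨v, hv, hv0⟩ := (Submodule.ne_bot_iff _).1 hF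
    have hv' : (v 0 : ℂ) * q x + (v 1 : ℂ) * polar q x y + (v 2 : ℂ) * q y = 0 := by
      simpa [F, Fintype.linearCombination_apply, Fin.sum_univ_three] using hv
    have hne : ¬ (v 0 = 0 ∧ v 1 = 0 ∧ v 2 = 0) := by
      rintro ⟨h0, h1, h2⟩
      apply hv0
      ext i
      fin_cases i <;> assumption
    rcases le_total 0 (v 0 + v 2) with h | h
    · exact ⟨v 0, v 1, v 2, hne, h, hv'⟩
    · refine ⟨-v 0, -v 1, -v 2, by simpa using hne, by linarith, ?_⟩
      push_cast
      linear_combination -hv'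
  -- `l` is the larger eigenvalue of the matrix `M` with rows `(α, β)` and `(β, γ)`; it is positive
  -- since `M ≠ 0` has nonnegative trace. Hence `1 - M / l` is positive semidefinite and singular,
  -- so it equals `v vᵀ` with `v = (a, b)`. Then `q (a x + b y)` is `q x + q y` minus `1 / l` times
  -- the relation `hrel`.
  set r := Real.sqrt (((α - γ) / 2) ^ 2 + β ^ 2) with hr
  have hr2 : r ^ 2 = ((α - γ) / 2) ^ 2 + β ^ 2 := Real.sq_sqrt (by positivity)
  have hr0 : 0 ≤ r := Real.sqrt_nonneg _
  set l := (α + γ) / 2 + r with hl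
  have hl0 : 0 < l := by
    rcases (add_nonneg (by linarith : 0 ≤ (α + γ) / 2) hr0).lt_or_eq with h | h
    · exact h
    · exfalso
      have hr' : r = 0 := by linarith
      have hs' : α + γ = 0 := by linarith
      rw [hr'] at hr2
      have hb : β = 0 := by nlinarith [sq_nonneg ((α - γ) / 2), sq_nonneg β]
      have hd : α - γ = 0 := by nlinarith [sq_nonneg ((α - γ) / 2), sq_nonneg β]
      exact hne ⟨by linarith, hb, by linarith⟩
  have habs : |(α - γ) / 2| ≤ r := Real.abs_le_sqrt (by nlinarith [sq_nonneg β])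
  have hA : 0 ≤ (l - α) / l := div_nonneg (by have := abs_le.1 habs; linarith) hl0.le
  have hC : 0 ≤ (l - γ) / l := div_nonneg (by have := abs_le.1 habs; linarith) hl0.le
  have hAC : ((l - α) / l) * ((l - γ) / l) = (β / l) ^ 2 := by
    field_simp
    rw [hl]
    linear_combination hr2
  obtain ⟨a, b, ha, hb, hab⟩ : ∃ a b : ℝ, a ^ 2 = (l - α) / l ∧ b ^ 2 = (l - γ) / l ∧
      a * b = -(β / l) := by
    have key : Real.sqrt ((l - α) / l) * Real.sqrt ((l - γ) / l) = |β / l| := by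
      rw [← Real.sqrt_mul hA, hAC, Real.sqrt_sq_eq_abs]
    rcases le_total 0 (β / l) with h | h
    · exact ⟨Real.sqrt ((l - α) / l), -Real.sqrt ((l - γ) / l), Real.sq_sqrt hA, by
        rw [neg_sq, Real.sq_sqrt hC], by rw [mul_neg, key, abs_of_nonneg h]⟩
    · exact ⟨Real.sqrt ((l - α) / l), Real.sqrt ((l - γ) / l), Real.sq_sqrt hA, Real.sq_sqrt hC,
        by rw [key, abs_of_nonpos h]⟩
  refine ⟨a • x + b • y, ?_⟩
  rw [map_smul_add_smul, ha, hb, hab]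
  have hlc : (l : ℂ) ≠ 0 := by exact_mod_cast hl0.ne'
  push_cast
  field_simp
  linear_combination -hrel

theorem sum_mem_range {ι : Type*} (s : Finset ι) (f : ι → ℂ) (hf : ∀ i ∈ s, f i ∈ Set.range q) :
    ∑ i ∈ s, f i ∈ Set.range q := by
  classical
  induction s using Finset.induction_on with
  | empty => exact ⟨0, by simp⟩
  | insert i s hi ih =>
    rw [Finset.sum_insert hi]
    exact q.add_mem_range (hf i (by simp)) (ih fun k hk => hf k (by simp [hk]))

variable {q}

/-- An elliptic quadratic map into the plane whose range contains a line is onto. -/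
theorem range_eq_univ_of_neg_mem (hq : ∀ x, q x = 0 → x = 0) {w : ℂ} (hw0 : w ≠ 0)
    (hw : w ∈ Set.range q) (hw' : -w ∈ Set.range q) : Set.range q = Set.univ := by
  have hreal : ∀ t : ℝ, (t : ℂ) * w ∈ Set.range q := by
    intro t
    rcases le_total 0 t with h | h
    · exact q.smul_mem_range h hw
    · have := q.smul_mem_range (neg_nonneg.2 h) hw'
      simpa using this
  obtain ⟨x, hx⟩ := hw
  obtain ⟨y, hy⟩ := hw'
  set p := polar q x y / w with hp
  have hpw : polar q x y = p * w := by rw [hp, div_mul_cancel₀ _ hw0]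
  have hval : ∀ a b : ℝ, q (a • x + b • y) = ((a ^ 2 - b ^ 2 : ℝ) + (a * b : ℝ) * p) * w := by
    intro a b
    rw [map_smul_add_smul, hx, hy, hpw]
    push_cast
    ring
  -- For real `p`, on the span of `x` and `y` the map would be `w` times a real indefinite form; its
  -- zero `a x + y` must vanish by ellipticity, so `y` is a multiple of `x`, against the opposite
  -- values `w` and `-w`.
  have him : p.im ≠ 0 := by
    intro him
    have hpr : p = (p.re : ℂ) := by apply Complex.ext <;> simp [him]
    set a := (-p.re + Real.sqrt (p.re ^ 2 + 4)) / 2 with ha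
    have hroot : a ^ 2 + a * p.re - 1 = 0 := by
      have := Real.sq_sqrt (by positivity : 0 ≤ p.re ^ 2 + 4)
      rw [ha]
      linear_combination this / 4
    have h0 : q (a • x + (1 : ℝ) • y) = 0 := by
      rw [hval, hpr, ← Complex.ofReal_mul, ← Complex.ofReal_add]
      have : a ^ 2 - 1 ^ 2 + a * 1 * p.re = 0 := by linarith
      rw [this]
      simp
    have h1 := hq _ h0
    rw [one_smul] at h1
    have h2 : y = (-a) • x := by rw [neg_smul]; exact eq_neg_of_add_eq_zero_right h1
    rw [h2, QuadraticMap.map_smul, hx, Complex.real_smul] at hy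
    have h3 : ((-a * -a + 1 : ℝ) : ℂ) * w = 0 := by
      push_cast
      push_cast at hy
      linear_combination hy
    rcases mul_eq_zero.1 h3 with h | h
    · have : -a * -a + 1 = 0 := by exact_mod_cast h
      nlinarith
    · exact hw0 h
  rw [Set.eq_univ_iff_forall]
  intro ζ
  -- `b` matches the imaginary part of `ζ / w`; what is missing is a real multiple of `w`, which may
  -- be added inside the range.
  set b := (ζ / w).im / p.im with hb
  have hbi : b * p.im = (ζ / w).im := by rw [hb, div_mul_cancel₀ _ him]
  have h1 : q ((1 : ℝ) • x + b • y) ∈ Set.range q := ⟨_, rfl⟩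
  rw [hval] at h1
  have h2 := q.add_mem_range h1 (hreal ((ζ / w).re - (1 - b ^ 2 + b * p.re)))
  convert h2 using 1
  rw [← add_mul, eq_comm, ← eq_div_iff hw0]
  apply Complex.ext
  · simp
  · simp [hbi]

end Range

/-! ### Closed range and coercivity -/

section Coercive

variable {V : Type*} [NormedAddCommGroup V] [NormedSpace ℝ V] [FiniteDimensional ℝ V]
  {q : QuadraticMap ℝ V ℂ}

theorem continuous_of_finiteDimensional (q : QuadraticMap ℝ V ℂ) : Continuous q := by
  have h : ∀ x, q x = associated (R := ℝ) q x x := fun x => (associated_eq_self_apply ℝ q x).symm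
  have h1 : Continuous fun x => LinearMap.toContinuousLinearMap (associated (R := ℝ) q x) :=
    (LinearMap.toContinuousLinearMap.toLinearMap ∘ₗ associated (R := ℝ) q).continuous_of_finiteDimensional
  have h2 : Continuous fun x => LinearMap.toContinuousLinearMap (associated (R := ℝ) q x) x :=
    h1.clm_apply continuous_id
  exact h2.congr fun x => (h x).symm

/-- A positive continuous 2-homogeneous function is bounded below by a multiple of `‖x‖ ^ 2`. -/
theorem exists_pos_mul_norm_sq_le {g : V → ℝ} (hg : Continuous g)
    (hhom : ∀ (t : ℝ) x, g (t • x) = t ^ 2 * g x) (hpos : ∀ x, x ≠ 0 → 0 < g x) :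
    ∃ δ : ℝ, 0 < δ ∧ ∀ x, δ * ‖x‖ ^ 2 ≤ g x := by
  obtain ⟨δ, hδ, h⟩ : ∃ δ : ℝ, 0 < δ ∧ ∀ x ∈ Metric.sphere (0 : V) 1, δ ≤ g x := by
    rcases (Metric.sphere (0 : V) 1).eq_empty_or_nonempty with he | hn
    · exact ⟨1, one_pos, by simp [he]⟩
    · obtain ⟨x, hx, hmin⟩ := (isCompact_sphere (0 : V) 1).exists_isMinOn hn hg.continuousOn
      refine ⟨g x, hpos x ?_, fun y hy => hmin hy⟩
      rintro rfl
      simp at hx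
  refine ⟨δ, hδ, fun x => ?_⟩
  rcases eq_or_ne x 0 with rfl | hx
  · have h0 : g 0 = 0 := by simpa using hhom 0 0
    simp [h0]
  have hx' : 0 < ‖x‖ := norm_pos_iff.2 hx
  have h1 := h (‖x‖⁻¹ • x) (by
    rw [mem_sphere_zero_iff_norm, norm_smul, norm_inv, norm_norm, inv_mul_cancel₀ hx'.ne'])
  rw [hhom, inv_pow, inv_mul_eq_div, le_div_iff₀ (by positivity)] at h1
  exact h1

/-- Ellipticity gives `δ ‖x‖² ≤ ‖q x‖`, so `q` is proper. Closedness is what makes the distance from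
an outside point to the range positive. -/
theorem isClosed_range_of_elliptic (hq : ∀ x, q x = 0 → x = 0) : IsClosed (Set.range q) := by
  obtain ⟨δ, hδ, h⟩ := exists_pos_mul_norm_sq_le (g := fun x => ‖q x‖)
    q.continuous_of_finiteDimensional.norm
    (fun t x => by
      rw [QuadraticMap.map_smul, norm_smul, Real.norm_of_nonneg (mul_self_nonneg t), pow_two])
    (fun x hx => norm_pos_iff.2 fun h => hx (hq x h))
  have hproper : IsProperMap q := by
    refine isProperMap_iff_tendsto_cocompact.2 ⟨q.continuous_of_finiteDimensional, ?_⟩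
    rw [← Metric.cobounded_eq_cocompact, ← Metric.cobounded_eq_cocompact,
      ← tendsto_norm_atTop_iff_cobounded]
    exact Filter.tendsto_atTop_mono h
      (((Filter.tendsto_pow_atTop two_ne_zero).comp tendsto_norm_cobounded_atTop).const_mul_atTop hδ)
  exact hproper.isClosedMap.isClosed_range

/-- An elliptic quadratic map into the plane that is not onto is coercive after rotation. -/
theorem exists_coercive (hq : ∀ x, q x = 0 → x = 0) (hne : Set.range q ≠ Set.univ) :
    ∃ (c : ℂ) (δ : ℝ), 0 < δ ∧ ∀ x, δ * ‖x‖ ^ 2 ≤ (c * q x).re := by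
  have hcont := q.continuous_of_finiteDimensional
  have hconv : Convex ℝ (Set.range q) := by
    rintro u hu v hv a b ha hb -
    rw [Complex.real_smul, Complex.real_smul]
    exact q.add_mem_range (q.smul_mem_range ha hu) (q.smul_mem_range hb hv)
  -- One functional must be positive on all of the sphere. Each point has a functional that is
  -- nonnegative on the range and positive nearby; by compactness finitely many suffice, and their
  -- sum works.
  obtain ⟨f, hf0, hf⟩ : ∃ f : ℂ →L[ℝ] ℝ, (∀ x, 0 ≤ f (q x)) ∧
      ∀ x ∈ Metric.sphere (0 : V) 1, 0 < f (q x) := by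
    refine (isCompact_sphere (0 : V) 1).induction_on
      (p := fun s => ∃ f : ℂ →L[ℝ] ℝ, (∀ x, 0 ≤ f (q x)) ∧ ∀ x ∈ s, 0 < f (q x))
      ⟨0, by simp, by simp⟩ ?_ ?_ ?_
    · rintro s t hst ⟨f, hf, hft⟩
      exact ⟨f, hf, fun x hx => hft x (hst hx)⟩
    · rintro s t ⟨f, hf, hfs⟩ ⟨g, hg, hgt⟩
      refine ⟨f + g, fun x => add_nonneg (hf x) (hg x), ?_⟩
      rintro x (hx | hx)
      · exact add_pos_of_pos_of_nonneg (hfs x hx) (hg x)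
      · exact add_pos_of_nonneg_of_pos (hf x) (hgt x hx)
    · intro x hx
      have hx0 : q x ≠ 0 := by
        intro h
        rw [hq x h] at hx
        simp at hx
      have hnot : -q x ∉ Set.range q := fun h =>
        hne (range_eq_univ_of_neg_mem hq hx0 ⟨x, rfl⟩ h)
      obtain ⟨f, u, hu, hf⟩ :=
        geometric_hahn_banach_point_closed hconv (isClosed_range_of_elliptic hq) hnot
      have hu0 : u < 0 := by simpa using hf 0 ⟨0, by simp⟩
      have hfx : 0 < f (q x) := by
        rw [map_neg] at hu
        linarith
      refine ⟨{y | 0 < f (q y)}, mem_nhdsWithin_of_mem_nhds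
        ((isOpen_lt continuous_const (f.continuous.comp hcont)).mem_nhds hfx), f, fun y => ?_,
        fun y hy => hy⟩
      -- If `f` were negative at `q y`, a nonnegative multiple of `q y` would take the value `u`
      -- exactly, against strict separation.
      by_contra! hy
      have h1 := hf _ (q.smul_mem_range (div_nonneg_of_nonpos hu0.le hy.le) ⟨y, rfl⟩)
      rw [← Complex.real_smul, map_smul, smul_eq_mul, div_mul_cancel₀ _ hy.ne] at h1
      exact lt_irrefl _ h1
  have hhom : ∀ (t : ℝ) x, f (q (t • x)) = t ^ 2 * f (q x) := fun t x => by
    rw [QuadraticMap.map_smul, map_smul, smul_eq_mul, pow_two]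
  obtain ⟨δ, hδ, h⟩ := exists_pos_mul_norm_sq_le (g := fun x => f (q x)) (f.continuous.comp hcont)
    hhom (fun x hx => by
      have hx' : 0 < ‖x‖ := norm_pos_iff.2 hx
      have h1 := hf (‖x‖⁻¹ • x) (by
        rw [mem_sphere_zero_iff_norm, norm_smul, norm_inv, norm_norm, inv_mul_cancel₀ hx'.ne'])
      rw [hhom] at h1
      exact pos_of_mul_pos_right h1 (by positivity))
  have hfre : ∀ w : ℂ, f w = (((f 1 : ℝ) - (f Complex.I : ℝ) * Complex.I) * w).re := by
    intro w
    have : w = w.re • (1 : ℂ) + w.im • Complex.I := by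
      rw [Complex.real_smul, Complex.real_smul, mul_one, Complex.re_add_im]
    conv_lhs => rw [this]
    rw [map_add, map_smul, map_smul]
    simp
    ring
  exact ⟨_, δ, hδ, fun x => (h x).trans_eq (hfre _)⟩

end Coercive

end QuadraticMap

/-! ### Quadratic expressions in symmetric operators -/

section QuadraticOperator

variable {I : Type*} [Fintype I] {S : Type*} [AddCommGroup S] [Module ℂ S]
  {H : Type*} [NormedAddCommGroup H] [InnerProductSpace ℂ H]

/-- The quadratic form `v ↦ ∑ m a b v a v b` with complex coefficients on real vectors. -/
def quadForm (m : I → I → ℂ) (v : I → ℝ) : ℂ :=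
  ∑ a, ∑ b, m a b * ((v a * v b : ℝ) : ℂ)

/-- The operator `∑ m a b L a L b`. -/
def quadOp (m : I → I → ℂ) (L : I → S →ₗ[ℂ] S) : S →ₗ[ℂ] S :=
  ∑ a, ∑ b, m a b • (L a ∘ₗ L b)

theorem quadOp_apply (m : I → I → ℂ) (L : I → S →ₗ[ℂ] S) (φ : S) :
    quadOp m L φ = ∑ a, ∑ b, m a b • L a (L b φ) := by
  simp [quadOp]

/-- The operator `∑ L a ^ 2`. -/
def sumSqOp (L : I → S →ₗ[ℂ] S) : S →ₗ[ℂ] S :=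
  ∑ a, L a ∘ₗ L a

theorem sumSqOp_apply (L : I → S →ₗ[ℂ] S) (φ : S) : sumSqOp L φ = ∑ a, L a (L a φ) := by
  simp [sumSqOp]

/-- The real part of a Gram matrix is a sum of squares. -/
theorem exists_gram_eq_sum (w : I → H) :
    ∃ v : I → I → ℝ, ∀ a b, (inner ℂ (w a) (w b)).re = ∑ k, v k a * v k b := by
  classical
  let := InnerProductSpace.rclikeToReal ℂ H
  have h := (Matrix.posSemidef_gram ℝ w)
  open scoped MatrixOrder in
  obtain ⟨B, hB⟩ := CStarAlgebra.nonneg_iff_eq_star_mul_self.mp h.nonneg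
  refine ⟨B, fun a b => ?_⟩
  have h1 : Matrix.gram ℝ w a b = ∑ k, B k a * B k b := by
    rw [hB, Matrix.mul_apply]
    simp [Matrix.star_apply]
  rw [← h1, Matrix.gram_apply]
  rfl

/-- The imaginary part of a Gram matrix is antisymmetric, so it drops out against a symmetric `m`.
-/
theorem sum_symm_mul_inner {m : I → I → ℂ} (hm : ∀ a b, m a b = m b a) (w : I → H) :
    ∑ a, ∑ b, m a b * inner ℂ (w a) (w b) =
      ∑ a, ∑ b, m a b * (((inner ℂ (w a) (w b)).re : ℝ) : ℂ) := by
  have h1 : ∑ a, ∑ b, m a b * inner ℂ (w a) (w b) = ∑ a, ∑ b, m a b * inner ℂ (w b) (w a) := by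
    rw [Finset.sum_comm]
    exact Finset.sum_congr rfl fun a _ => Finset.sum_congr rfl fun b _ => by rw [hm]
  have h2 : ∀ a b, (((inner ℂ (w a) (w b)).re : ℝ) : ℂ) =
      (inner ℂ (w a) (w b) + inner ℂ (w b) (w a)) / 2 := by
    intro a b
    rw [← inner_conj_symm (w b) (w a), Complex.add_conj]
    simp
  simp_rw [h2, mul_div_assoc', mul_add, ← Finset.sum_div, Finset.sum_add_distrib]
  rw [← h1]
  ring

variable {j : S →ₗ[ℂ] H} {L : I → S →ₗ[ℂ] S} {m : I → I → ℂ}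

/-- The expectation of a quadratic operator is a sum of values of the quadratic form. -/
theorem exists_inner_quadOp_eq_sum
    (hsym : ∀ a φ ψ, inner ℂ (j (L a φ)) (j ψ) = inner ℂ (j φ) (j (L a ψ)))
    (hm : ∀ a b, m a b = m b a) (φ : S) :
    ∃ v : I → I → ℝ, inner ℂ (j φ) (j (quadOp m L φ)) = ∑ k, quadForm m (v k) ∧
      ∑ k, ∑ a, v k a ^ 2 = ∑ a, ‖j (L a φ)‖ ^ 2 := by
  obtain ⟨v, hv⟩ := exists_gram_eq_sum fun a => j (L a φ)
  refine ⟨v, ?_, ?_⟩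
  · have h1 : inner ℂ (j φ) (j (quadOp m L φ)) =
        ∑ a, ∑ b, m a b * inner ℂ (j (L a φ)) (j (L b φ)) := by
      simp only [quadOp_apply, map_sum, map_smul, inner_sum, inner_smul_right, hsym]
    rw [h1, sum_symm_mul_inner hm]
    simp_rw [hv, quadForm]
    rw [Finset.sum_comm]
    conv_rhs => rw [Finset.sum_comm]; enter [2, a]; rw [Finset.sum_comm]
    rw [Finset.sum_comm]
    refine Finset.sum_congr rfl fun a _ => Finset.sum_congr rfl fun b _ => ?_
    rw [Complex.ofReal_sum, Finset.mul_sum]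
  · rw [Finset.sum_comm]
    refine Finset.sum_congr rfl fun a _ => ?_
    rw [← inner_self_eq_norm_sq (𝕜 := ℂ)]
    have := hv a a
    simp only [pow_two]
    rw [← this]
    rfl

/-- Lower bound by the distance to the range of the form. -/
theorem infDist_mul_norm_sq_le {V : Type*} [AddCommGroup V] [Module ℝ V]
    {q : QuadraticMap ℝ V ℂ}
    (hsym : ∀ a φ ψ, inner ℂ (j (L a φ)) (j ψ) = inner ℂ (j φ) (j (L a ψ)))
    (hm : ∀ a b, m a b = m b a) (hq : ∀ v, quadForm m v ∈ Set.range q) (z : ℂ) (φ : S) :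
    Metric.infDist z (Set.range q) * ‖j φ‖ ^ 2 ≤
      ‖inner ℂ (j φ) (j (quadOp m L φ) - z • j φ)‖ := by
  obtain ⟨v, hv, -⟩ := exists_inner_quadOp_eq_sum hsym hm φ
  have hmem : inner ℂ (j φ) (j (quadOp m L φ)) ∈ Set.range q := by
    rw [hv]
    exact q.sum_mem_range _ _ fun k _ => hq _
  rcases eq_or_ne (‖j φ‖) 0 with h0 | h0
  · rw [h0]
    simp
  have hpos : 0 < ‖j φ‖ ^ 2 := by positivity
  have hmem' := q.smul_mem_range (inv_nonneg.2 hpos.le) hmem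
  have h1 := Metric.infDist_le_dist_of_mem (x := z) hmem'
  rw [dist_comm, dist_eq_norm] at h1
  calc Metric.infDist z (Set.range q) * ‖j φ‖ ^ 2
      ≤ ‖(((‖j φ‖ ^ 2)⁻¹ : ℝ) : ℂ) * inner ℂ (j φ) (j (quadOp m L φ)) - z‖ * ‖j φ‖ ^ 2 := by gcongr
    _ = ‖((((‖j φ‖ ^ 2)⁻¹ : ℝ) : ℂ) * inner ℂ (j φ) (j (quadOp m L φ)) - z) *
          ((‖j φ‖ ^ 2 : ℝ) : ℂ)‖ := by
        rw [norm_mul, Complex.norm_real, Real.norm_of_nonneg hpos.le]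
    _ = _ := by
        congr 1
        rw [inner_sub_right, inner_smul_right, inner_self_eq_norm_sq_to_K]
        have : (‖j φ‖ : ℂ) ≠ 0 := by exact_mod_cast h0
        push_cast
        field_simp
        exact congrArg _ (mul_comm _ _)

/-- Galerkin approximation on a finite-dimensional subspace. -/
theorem exists_galerkin (E : Submodule ℂ S) [FiniteDimensional ℂ E] (hj : Function.Injective j)
    (T : S →ₗ[ℂ] H) (hT : ∀ u ∈ E, inner ℂ (j u) (T u) = 0 → u = 0) (f : H) :
    ∃ u ∈ E, ∀ v ∈ E, inner ℂ (j v) (T u - f) = 0 := by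
  let F : Submodule ℂ H := E.map j
  have hF : Module.finrank ℂ E = Module.finrank ℂ F :=
    (Submodule.equivMapOfInjective j hj E).finrank_eq
  -- The compression of `T` acts between spaces of equal dimension, and `hT` makes it injective,
  -- hence onto.
  let A : E →ₗ[ℂ] F := F.orthogonalProjectionOnto.toLinearMap ∘ₗ T ∘ₗ E.subtype
  have hA : ∀ (u v : S) (hu : u ∈ E) (_ : v ∈ E),
      inner ℂ (j v) (T u) = inner ℂ (j v) (A ⟨u, hu⟩ : H) := by
    intro u v hu hv
    have h := F.inner_orthogonalProjectionOnto_eq_of_mem_left ⟨j v, Submodule.mem_map_of_mem hv⟩ (T u)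
    exact h.symm
  have hinj : Function.Injective A := by
    rw [← LinearMap.ker_eq_bot, LinearMap.ker_eq_bot']
    rintro ⟨u, hu⟩ h
    have := hA u u hu hu
    rw [h] at this
    exact Subtype.ext (hT u hu (by simpa using this))
  obtain ⟨⟨u, hu⟩, hAu⟩ :=
    (LinearMap.injective_iff_surjective_of_finrank_eq_finrank hF).1 hinj (F.orthogonalProjectionOnto f)
  refine ⟨u, hu, fun v hv => ?_⟩
  have h := F.inner_orthogonalProjectionOnto_eq_of_mem_left ⟨j v, Submodule.mem_map_of_mem hv⟩ f
  rw [inner_sub_right, hA u v hu hv, hAu]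
  exact sub_eq_zero.2 h

theorem mul_le_sum_sq (x : I → ℝ) (a b : I) : x a * x b ≤ ∑ k, x k ^ 2 := by
  have ha := Finset.single_le_sum (f := fun k => x k ^ 2) (fun k _ => sq_nonneg (x k))
    (Finset.mem_univ a)
  have hb := Finset.single_le_sum (f := fun k => x k ^ 2) (fun k _ => sq_nonneg (x k))
    (Finset.mem_univ b)
  nlinarith [sq_nonneg (x a - x b)]

/-- Commutators of `L a` with a quadratic operator are of first order. -/
theorem norm_sum_inner_commutator_le {κ : I → I → ℂ}
    (hcomm : ∀ a b φ, L a (L b φ) = L b (L a φ) + κ a b • φ) (m : I → I → ℂ) (u : S) :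
    ‖∑ a, inner ℂ (j (L a u)) (j (L a (quadOp m L u)) - j (quadOp m L (L a u)))‖ ≤
      (∑ a, ∑ b, ∑ c, ‖m b c‖ * (‖κ a b‖ + ‖κ a c‖)) * ∑ a, ‖j (L a u)‖ ^ 2 := by
  -- This is `[L a, L b L c] = κ a b L c + κ a c L b`, the commutators being scalars.
  have hterm : ∀ a, L a (quadOp m L u) - quadOp m L (L a u) =
      ∑ b, ∑ c, m b c • (κ a b • L c u + κ a c • L b u) := by
    intro a
    simp only [quadOp_apply, map_sum, map_smul, ← Finset.sum_sub_distrib, ← smul_sub]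
    refine Finset.sum_congr rfl fun b _ => Finset.sum_congr rfl fun c _ => ?_
    congr 1
    rw [hcomm a b, hcomm a c, map_add, map_smul]
    abel
  simp_rw [← map_sub, hterm, map_sum, map_smul, map_add, map_smul, inner_sum, inner_smul_right,
    inner_add_right, inner_smul_right, Finset.sum_mul]
  refine (norm_sum_le _ _).trans (Finset.sum_le_sum fun a _ => ?_)
  refine (norm_sum_le _ _).trans (Finset.sum_le_sum fun b _ => ?_)
  refine (norm_sum_le _ _).trans (Finset.sum_le_sum fun c _ => ?_)
  rw [norm_mul, mul_assoc]
  refine mul_le_mul_of_nonneg_left ?_ (norm_nonneg _)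
  refine (norm_add_le _ _).trans ?_
  rw [norm_mul, norm_mul, add_mul]
  gcongr
  · exact (norm_inner_le_norm _ _).trans (mul_le_sum_sq (fun k => ‖j (L k u)‖) a c)
  · exact (norm_inner_le_norm _ _).trans (mul_le_sum_sq (fun k => ‖j (L k u)‖) a b)

theorem sum_norm_sq_le_norm_mul_norm_sumSqOp
    (hsym : ∀ a φ ψ, inner ℂ (j (L a φ)) (j ψ) = inner ℂ (j φ) (j (L a ψ))) (u : S) :
    ∑ a, ‖j (L a u)‖ ^ 2 ≤ ‖j u‖ * ‖j (sumSqOp L u)‖ := by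
  have h1 : inner ℂ (j u) (j (sumSqOp L u)) = ((∑ a, ‖j (L a u)‖ ^ 2 : ℝ) : ℂ) := by
    rw [sumSqOp_apply, map_sum, inner_sum]
    push_cast
    refine Finset.sum_congr rfl fun a _ => ?_
    rw [← hsym, inner_self_eq_norm_sq_to_K]
    rfl
  have h2 := norm_inner_le_norm (𝕜 := ℂ) (j u) (j (sumSqOp L u))
  rw [h1, Complex.norm_real, Real.norm_of_nonneg (by positivity)] at h2
  exact h2

/-- Coercivity is applied to each vector `v k` in the decomposition of the expectation; the squares
of the `v k` add up to `∑ ‖L a w‖²`. -/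
theorem mul_sum_norm_sq_le_re_inner_quadOp
    (hsym : ∀ a φ ψ, inner ℂ (j (L a φ)) (j ψ) = inner ℂ (j φ) (j (L a ψ)))
    (hm : ∀ a b, m a b = m b a) {c : ℂ} {δ : ℝ}
    (hcoer : ∀ v, δ * ∑ a, v a ^ 2 ≤ (c * quadForm m v).re) (w : S) :
    δ * ∑ a, ‖j (L a w)‖ ^ 2 ≤ (c * inner ℂ (j w) (j (quadOp m L w))).re := by
  obtain ⟨v, hv, hv'⟩ := exists_inner_quadOp_eq_sum hsym hm w
  rw [hv, ← hv', Finset.mul_sum, Finset.mul_sum, Complex.re_sum]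
  exact Finset.sum_le_sum fun k _ => hcoer _

/-- Gårding type inequality of second order for quadratic operators. -/
theorem exists_garding {κ : I → I → ℂ}
    (hsym : ∀ a φ ψ, inner ℂ (j (L a φ)) (j ψ) = inner ℂ (j φ) (j (L a ψ)))
    (hcomm : ∀ a b φ, L a (L b φ) = L b (L a φ) + κ a b • φ)
    (hm : ∀ a b, m a b = m b a) {c : ℂ} {δ : ℝ}
    (hcoer : ∀ v, δ * ∑ a, v a ^ 2 ≤ (c * quadForm m v).re) :
    ∃ C : ℝ, 0 ≤ C ∧ ∀ u : S, δ * ∑ a, ∑ b, ‖j (L b (L a u))‖ ^ 2 ≤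
      ‖c‖ * (‖inner ℂ (j (sumSqOp L u)) (j (quadOp m L u))‖ +
        C * (‖j u‖ * ‖j (sumSqOp L u)‖)) := by
  refine ⟨∑ a, ∑ b, ∑ c, ‖m b c‖ * (‖κ a b‖ + ‖κ a c‖), by positivity, fun u => ?_⟩
  -- One factor `L a` of each square is moved to the other side and commuted past the operator,
  -- leaving the expectation at `L a u`, where coercivity applies.
  have hQ : inner ℂ (j (sumSqOp L u)) (j (quadOp m L u)) =
      ∑ a, inner ℂ (j (L a u)) (j (quadOp m L (L a u))) +
        ∑ a, inner ℂ (j (L a u)) (j (L a (quadOp m L u)) - j (quadOp m L (L a u))) := by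
    rw [← Finset.sum_add_distrib, sumSqOp_apply, map_sum, sum_inner]
    refine Finset.sum_congr rfl fun a _ => ?_
    rw [← inner_add_right, add_sub_cancel, ← hsym]
  have h1 : δ * ∑ a, ∑ b, ‖j (L b (L a u))‖ ^ 2 ≤
      (c * ∑ a, inner ℂ (j (L a u)) (j (quadOp m L (L a u)))).re := by
    rw [Finset.mul_sum, Finset.mul_sum, Complex.re_sum]
    exact Finset.sum_le_sum fun a _ => mul_sum_norm_sq_le_re_inner_quadOp hsym hm hcoer (L a u)
  rw [← sub_eq_iff_eq_add] at hQ
  rw [← hQ] at h1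
  refine h1.trans ((Complex.re_le_norm _).trans ?_)
  rw [norm_mul]
  refine mul_le_mul_of_nonneg_left ?_ (norm_nonneg c)
  refine (norm_sub_le _ _).trans (add_le_add_right ?_ _)
  exact (norm_sum_inner_commutator_le hcomm m u).trans (mul_le_mul_of_nonneg_left
    (sum_norm_sq_le_norm_mul_norm_sumSqOp hsym u) (by positivity))

/-- Second order a priori estimate for elliptic quadratic operators. -/
theorem exists_elliptic_estimate {κ : I → I → ℂ}
    (hsym : ∀ a φ ψ, inner ℂ (j (L a φ)) (j ψ) = inner ℂ (j φ) (j (L a ψ)))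
    (hcomm : ∀ a b φ, L a (L b φ) = L b (L a φ) + κ a b • φ)
    (hm : ∀ a b, m a b = m b a) {c : ℂ} {δ : ℝ} (hδ : 0 < δ)
    (hcoer : ∀ v, δ * ∑ a, v a ^ 2 ≤ (c * quadForm m v).re) (z : ℂ) :
    ∃ C : ℝ, 0 ≤ C ∧ ∀ (u : S) (f : H),
      inner ℂ (j (sumSqOp L u)) (j (quadOp m L u) - z • j u - f) = 0 →
      (∀ a, ‖j (L a u)‖ ≤ C * (‖f‖ + ‖j u‖)) ∧
        ∀ a b, ‖j (L a (L b u))‖ ≤ C * (‖f‖ + ‖j u‖) := by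
  obtain ⟨C₁, hC₁, hgarding⟩ := exists_garding (j := j) hsym hcomm hm hcoer
  obtain ⟨N, hN0, hN⟩ : ∃ N : ℝ, 0 ≤ N ∧ N = (Fintype.card I : ℕ) := ⟨_, Nat.cast_nonneg _, rfl⟩
  -- With `s² = ∑ ‖L b L a u‖²` and `‖∑ L a ^ 2 u‖ ≤ N s`, the Gårding inequality becomes `δ s² ≤ C
  -- δ (‖f‖ + ‖u‖) s`. The final constant `1 + C + N C` also covers first order, where `N C` is
  -- needed under a square root.
  obtain ⟨C, hC0, hC⟩ : ∃ C : ℝ, 0 ≤ C ∧ C * δ = N * (‖c‖ * (1 + ‖z‖ + C₁)) :=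
    ⟨N * (‖c‖ * (1 + ‖z‖ + C₁)) / δ, by positivity, div_mul_cancel₀ _ hδ.ne'⟩
  refine ⟨1 + C + N * C, by positivity, fun u f hf => ?_⟩
  have hn1 := sum_norm_sq_le_norm_mul_norm_sumSqOp hsym u
  have hg := hgarding u
  have hQ : ‖inner ℂ (j (sumSqOp L u)) (j (quadOp m L u))‖ ≤
      ‖j (sumSqOp L u)‖ * (‖f‖ + ‖z‖ * ‖j u‖) := by
    rw [inner_sub_right, inner_sub_right, sub_sub, sub_eq_zero, ← inner_add_right] at hf
    rw [hf]
    refine (norm_inner_le_norm _ _).trans (mul_le_mul_of_nonneg_left ?_ (norm_nonneg _))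
    refine (norm_add_le _ _).trans ?_
    rw [norm_smul, add_comm]
  generalize hh : ‖j (sumSqOp L u)‖ = h at hn1 hg hQ
  have hh0 : 0 ≤ h := hh ▸ norm_nonneg _
  obtain ⟨s, hs0, hs2⟩ : ∃ s : ℝ, 0 ≤ s ∧ s ^ 2 = ∑ a, ∑ b, ‖j (L b (L a u))‖ ^ 2 :=
    ⟨_, Real.sqrt_nonneg _, Real.sq_sqrt (by positivity)⟩
  have hle : ∀ a b, ‖j (L a (L b u))‖ ≤ s := by
    intro a b
    refine (abs_le_of_sq_le_sq' ?_ hs0).2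
    have h1 := Finset.single_le_sum (f := fun a => ‖j (L a (L b u))‖ ^ 2)
      (fun k _ => sq_nonneg _) (Finset.mem_univ a)
    have h2 := Finset.single_le_sum (f := fun b => ∑ a, ‖j (L a (L b u))‖ ^ 2)
      (fun k _ => Finset.sum_nonneg fun _ _ => sq_nonneg _) (Finset.mem_univ b)
    rw [hs2]
    exact h1.trans h2
  have hhs : h ≤ N * s := by
    rw [← hh, sumSqOp_apply, map_sum]
    refine (norm_sum_le _ _).trans ((Finset.sum_le_sum fun a _ => hle a a).trans_eq ?_)
    simp [hN]
  rw [← hs2] at hg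
  have hf0 := norm_nonneg f
  have hu0 := norm_nonneg (j u)
  have hz0 := norm_nonneg z
  have hc0 := norm_nonneg c
  generalize ‖inner ℂ (j (sumSqOp L u)) (j (quadOp m L u))‖ = Q at hg hQ
  have hsC : s ≤ C * (‖f‖ + ‖j u‖) := by
    rcases hs0.eq_or_lt with h0 | h0
    · rw [← h0]; positivity
    have h1 : Q + C₁ * (‖j u‖ * h) ≤ (1 + ‖z‖ + C₁) * (‖f‖ + ‖j u‖) * h := by
      have h6 : 0 ≤ h * (‖j u‖ + (‖z‖ + C₁) * ‖f‖) := by positivity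
      linarith
    have h2 : δ * s ^ 2 ≤ ‖c‖ * ((1 + ‖z‖ + C₁) * (‖f‖ + ‖j u‖) * (N * s)) :=
      hg.trans (mul_le_mul_of_nonneg_left
        (h1.trans (mul_le_mul_of_nonneg_left hhs (by positivity))) hc0)
    have h3 : s * (δ * s) ≤ C * (‖f‖ + ‖j u‖) * (δ * s) := by
      calc s * (δ * s) = δ * s ^ 2 := by ring
        _ ≤ _ := h2
        _ = (C * δ) * ((‖f‖ + ‖j u‖) * s) := by rw [hC]; ring
        _ = _ := by ring
    exact le_of_mul_le_mul_right h3 (by positivity)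
  have hNC : 0 ≤ N * C := by positivity
  constructor
  · intro a
    have h1 : ‖j (L a u)‖ ^ 2 ≤ ‖j u‖ * h :=
      (Finset.single_le_sum (f := fun a => ‖j (L a u)‖ ^ 2) (fun k _ => sq_nonneg _)
        (Finset.mem_univ a)).trans hn1
    have h2 : ‖j u‖ * h ≤ (‖f‖ + ‖j u‖) * (N * (C * (‖f‖ + ‖j u‖))) :=
      mul_le_mul (by linarith) (hhs.trans (mul_le_mul_of_nonneg_left hsC hN0)) hh0 (by positivity)
    refine (abs_le_of_sq_le_sq' ?_ (by positivity)).2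
    have h4 : N * C ≤ (1 + C + N * C) ^ 2 := by nlinarith
    calc ‖j (L a u)‖ ^ 2 ≤ (‖f‖ + ‖j u‖) * (N * (C * (‖f‖ + ‖j u‖))) := h1.trans h2
      _ = N * C * (‖f‖ + ‖j u‖) ^ 2 := by ring
      _ ≤ (1 + C + N * C) ^ 2 * (‖f‖ + ‖j u‖) ^ 2 := by gcongr
      _ = _ := by ring
  · intro a b
    refine (hle a b).trans (hsC.trans (mul_le_mul_of_nonneg_right ?_ (by positivity)))
    linarith

end QuadraticOperator

/-! ### Position and momentum operators on Schwartz functions -/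

section PhaseOperators

variable {n : ℕ}

/-- The coordinate `x i` as a continuous linear map. -/
noncomputable def coordCLM (i : Fin n) : RSpace n →L[ℝ] ℂ :=
  Complex.ofRealCLM ∘L (EuclideanSpace.proj i : RSpace n →L[ℝ] ℝ)

theorem coordCLM_apply (i : Fin n) (x : RSpace n) : coordCLM i x = ((x i : ℝ) : ℂ) := rfl

theorem hasTemperateGrowth_coord (i : Fin n) :
    (fun x : RSpace n => ((x i : ℝ) : ℂ)).HasTemperateGrowth :=
  (coordCLM i).hasTemperateGrowth

/-- Multiplication by the coordinate `x i` on Schwartz functions. -/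
noncomputable def posOp (i : Fin n) : 𝓢(RSpace n, ℂ) →ₗ[ℂ] 𝓢(RSpace n, ℂ) :=
  (SchwartzMap.smulLeftCLM ℂ (fun x : RSpace n => ((x i : ℝ) : ℂ))).toLinearMap

/-- The partial derivative `∂ i` on Schwartz functions. -/
noncomputable def derOp (i : Fin n) : 𝓢(RSpace n, ℂ) →ₗ[ℂ] 𝓢(RSpace n, ℂ) :=
  (LineDeriv.lineDerivOpCLM ℂ 𝓢(RSpace n, ℂ) (EuclideanSpace.single i (1 : ℝ))).toLinearMap

/-- The operators `x i` and `D i = -i ∂ i`, indexed by the coordinates of phase space. -/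
noncomputable def phaseOp : Fin n ⊕ Fin n → 𝓢(RSpace n, ℂ) →ₗ[ℂ] 𝓢(RSpace n, ℂ) :=
  Sum.elim posOp fun i => (-Complex.I) • derOp i

theorem phaseOp_inl (i : Fin n) : phaseOp (Sum.inl i) = posOp i := rfl

theorem phaseOp_inr (i : Fin n) : phaseOp (Sum.inr i) = (-Complex.I) • derOp i := rfl

theorem posOp_apply (i : Fin n) (φ : 𝓢(RSpace n, ℂ)) (x : RSpace n) :
    posOp i φ x = (x i : ℂ) * φ x :=
  SchwartzMap.smulLeftCLM_apply_apply (hasTemperateGrowth_coord i) φ x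

theorem derOp_eq (i : Fin n) (φ : 𝓢(RSpace n, ℂ)) :
    derOp i φ = ∂_{EuclideanSpace.single i (1 : ℝ)} φ := rfl

theorem derOp_apply (i : Fin n) (φ : 𝓢(RSpace n, ℂ)) (x : RSpace n) :
    derOp i φ x = fderiv ℝ φ x (EuclideanSpace.single i (1 : ℝ)) := rfl

theorem posOp_posOp (i k : Fin n) (φ : 𝓢(RSpace n, ℂ)) :
    posOp i (posOp k φ) = posOp k (posOp i φ) := by
  ext x
  simp only [posOp_apply]
  ring

theorem derOp_posOp (i k : Fin n) (φ : 𝓢(RSpace n, ℂ)) :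
    derOp i (posOp k φ) = posOp k (derOp i φ) + (if i = k then (1 : ℂ) else 0) • φ := by
  ext x
  have h : (posOp k φ : RSpace n → ℂ) = fun x => coordCLM k x * φ x :=
    funext fun x => posOp_apply k φ x
  have hd : HasFDerivAt (fun x => coordCLM k x * φ x)
      (coordCLM k x • fderiv ℝ φ x + φ x • coordCLM k) x :=
    (coordCLM k).hasFDerivAt.mul φ.differentiableAt.hasFDerivAt
  rw [derOp_apply, h, hd.fderiv]
  simp only [add_apply, smul_apply, posOp_apply, derOp_apply, coordCLM_apply, smul_eq_mul,
    PiLp.single_apply]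
  rcases eq_or_ne i k with rfl | hik
  · simp
  · simp [hik, hik.symm]

theorem derOp_derOp (i k : Fin n) (φ : 𝓢(RSpace n, ℂ)) :
    derOp i (derOp k φ) = derOp k (derOp i φ) := by
  ext x
  have h : ∀ v w : RSpace n, ∂_{v} (∂_{w} φ) x = fderiv ℝ (fderiv ℝ φ) x v w := by
    intro v w
    rw [lineDerivOp_apply_eq_fderiv]
    have hd : HasFDerivAt (fderiv ℝ φ) (fderiv ℝ (fderiv ℝ φ) x) x :=
      (fderivCLM ℝ (RSpace n) ℂ φ).differentiableAt.hasFDerivAt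
    have h2 : HasFDerivAt (∂_{w} φ : 𝓢(RSpace n, ℂ))
        ((fderiv ℝ (fderiv ℝ φ) x).flip w) x := by
      have := hd.clm_apply (hasFDerivAt_const w x)
      rw [ContinuousLinearMap.comp_zero, zero_add] at this
      exact this
    rw [h2.fderiv]
    rfl
  rw [derOp_eq, derOp_eq, derOp_eq, derOp_eq, h, h]
  have hsymm : IsSymmSndFDerivAt ℝ φ x :=
    (φ.contDiffAt 2).isSymmSndFDerivAt (by simp)
  exact hsymm _ _

/-- The commutators of the phase space operators. -/
noncomputable def phaseComm : Fin n ⊕ Fin n → Fin n ⊕ Fin n → ℂ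
  | Sum.inl i, Sum.inr k => if k = i then Complex.I else 0
  | Sum.inr i, Sum.inl k => if i = k then -Complex.I else 0
  | _, _ => 0

theorem phaseOp_comm (a b : Fin n ⊕ Fin n) (φ : 𝓢(RSpace n, ℂ)) :
    phaseOp a (phaseOp b φ) = phaseOp b (phaseOp a φ) + phaseComm a b • φ := by
  rcases a with i | i <;> rcases b with k | k
  · simp [phaseOp_inl, phaseComm, posOp_posOp i k]
  · simp only [phaseOp_inl, phaseOp_inr, phaseComm, LinearMap.smul_apply, map_smul, derOp_posOp,
      smul_add]
    split_ifs <;> simp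
  · simp only [phaseOp_inl, phaseOp_inr, phaseComm, LinearMap.smul_apply, map_smul, derOp_posOp,
      smul_add]
    split_ifs <;> simp
  · simp [phaseOp_inr, phaseComm, derOp_derOp i k]

/-- The embedding of Schwartz functions into `L²`. -/
noncomputable def toL2 : 𝓢(RSpace n, ℂ) →ₗ[ℂ] L2 n :=
  (toLpCLM ℂ ℂ 2 (volume : Measure (RSpace n))).toLinearMap

theorem coeFn_toL2 (φ : 𝓢(RSpace n, ℂ)) : (toL2 φ : RSpace n → ℂ) =ᵐ[volume] φ :=
  φ.coeFn_toLp 2 volume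

theorem toL2_injective : Function.Injective (toL2 (n := n)) :=
  injective_toLp 2 (volume : Measure (RSpace n))

theorem inner_toL2 (φ ψ : 𝓢(RSpace n, ℂ)) :
    inner ℂ (toL2 φ) (toL2 ψ) = ∫ x, inner ℂ (φ x) (ψ x) :=
  inner_toL2_toL2_eq φ ψ volume

theorem phaseOp_symm (a : Fin n ⊕ Fin n) (φ ψ : 𝓢(RSpace n, ℂ)) :
    inner ℂ (toL2 (phaseOp a φ)) (toL2 ψ) = inner ℂ (toL2 φ) (toL2 (phaseOp a ψ)) := by
  rcases a with i | i
  · rw [inner_toL2, inner_toL2]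
    congr 1
    ext x
    simp only [phaseOp_inl, posOp_apply, RCLike.inner_apply, map_mul, Complex.conj_ofReal]
    ring
  · simp only [phaseOp_inr, LinearMap.smul_apply, map_smul, inner_smul_left, inner_smul_right,
      inner_toL2, derOp_eq]
    have h := integral_bilinear_lineDerivOp_right_eq_neg_left (μ := volume) φ ψ
      ((ContinuousLinearMap.mul ℝ ℂ).comp (Complex.conjCLE : ℂ →L[ℝ] ℂ))
      (EuclideanSpace.single i (1 : ℝ))
    simp only [ContinuousLinearMap.comp_apply, ContinuousLinearMap.mul_apply',
      ContinuousLinearEquiv.coe_coe, Complex.conjCLE_apply] at h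
    simp only [RCLike.inner_apply, mul_comm _ ((starRingEnd ℂ) _), h]
    simp

/-- The sign of a phase space operator under transposition. -/
def phaseSign : Fin n ⊕ Fin n → ℝ := Sum.elim (fun _ => 1) fun _ => -1

theorem integral_phaseOp_mul (a : Fin n ⊕ Fin n) (φ ψ : 𝓢(RSpace n, ℂ)) :
    ∫ x, phaseOp a φ x * ψ x = phaseSign a * ∫ x, φ x * phaseOp a ψ x := by
  rcases a with i | i
  · simp only [phaseSign, phaseOp_inl, posOp_apply, Sum.elim_inl, Complex.ofReal_one, one_mul]
    congr 1
    ext x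
    ring
  · have h := integral_mul_lineDerivOp_right_eq_neg_left (μ := volume) φ ψ
      (EuclideanSpace.single i (1 : ℝ))
    simp only [phaseOp_inr, phaseSign, LinearMap.smul_apply, smul_apply, smul_eq_mul,
      Sum.elim_inr, mul_assoc, mul_left_comm _ (-Complex.I), integral_const_mul, derOp_eq, h]
    push_cast
    ring

end PhaseOperators

/-! ### The Gaussian as a Schwartz function -/

section Gaussian

variable {n : ℕ}

theorem exists_pow_mul_exp_neg_le (K : ℕ) :
    ∃ C : ℝ, 0 ≤ C ∧ ∀ t : ℝ, 0 ≤ t → (1 + t) ^ K * Real.exp (-(t ^ 2 / 2)) ≤ C := by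
  -- `3 / 2` is the maximum of `1 + t - t² / 2`, attained at `t = 1`.
  refine ⟨K.factorial * Real.exp (3 / 2), by positivity, fun t ht => ?_⟩
  have h1 : (1 + t) ^ K ≤ K.factorial * Real.exp (1 + t) := by
    have := Real.pow_div_factorial_le_exp (x := 1 + t) (by linarith) K
    rwa [div_le_iff₀ (by positivity), mul_comm] at this
  calc (1 + t) ^ K * Real.exp (-(t ^ 2 / 2))
      ≤ K.factorial * Real.exp (1 + t) * Real.exp (-(t ^ 2 / 2)) := by gcongr
    _ = K.factorial * Real.exp (1 + t + -(t ^ 2 / 2)) := by rw [mul_assoc, ← Real.exp_add]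
    _ ≤ K.factorial * Real.exp (3 / 2) := by
        gcongr
        nlinarith [sq_nonneg (t - 1)]

/-- All derivatives of `exp` equal `exp` and those of the exponent grow polynomially, so the chain
rule bound is a polynomial times the Gaussian. -/
theorem gaussian_decay (k m : ℕ) :
    ∃ C, ∀ x : RSpace n,
      ‖x‖ ^ k * ‖iteratedFDeriv ℝ m (fun x : RSpace n => Real.exp (-(‖x‖ ^ 2 / 2))) x‖ ≤ C := by
  have hf : (fun x : RSpace n => -(‖x‖ ^ 2 / 2)).HasTemperateGrowth := by
    have h := (Function.hasTemperateGrowth_norm_sq (H := RSpace n)).mul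
      (Function.HasTemperateGrowth.const (-(1 / 2) : ℝ))
    have heq : (fun x : RSpace n => -(‖x‖ ^ 2 / 2)) = fun x => ‖x‖ ^ 2 * -(1 / 2) :=
      funext fun x => by ring
    rw [heq]
    exact h
  obtain ⟨l, C, hC, hbound⟩ := hf.norm_iteratedFDeriv_le_uniform m
  obtain ⟨C', hC', hexp⟩ := exists_pow_mul_exp_neg_le (k + l * m)
  refine ⟨m.factorial * (1 + C) ^ m * C', fun x => ?_⟩
  have hx := norm_nonneg x
  have h1 : 1 ≤ (1 + ‖x‖) ^ l := one_le_pow₀ (by linarith)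
  have hD1 : 1 ≤ (1 + C) * (1 + ‖x‖) ^ l := one_le_mul_of_one_le_of_one_le (by linarith) h1
  have hcomp := norm_iteratedFDeriv_comp_le (𝕜 := ℝ) (N := ((⊤ : ℕ∞) : WithTop ℕ∞))
    (g := Real.exp) (f := fun x : RSpace n => -(‖x‖ ^ 2 / 2)) (n := m)
    Real.contDiff_exp hf.1 (by exact_mod_cast le_top) x
    (C := Real.exp (-(‖x‖ ^ 2 / 2))) (D := (1 + C) * (1 + ‖x‖) ^ l)
    (fun i _ => by
      rw [norm_iteratedFDeriv_eq_norm_iteratedDeriv, iteratedDeriv_eq_iterate,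
        Real.iter_deriv_exp, Real.norm_of_nonneg (Real.exp_pos _).le])
    (fun i hi him => by
      refine (hbound i him x).trans (le_trans ?_ (le_self_pow₀ hD1 (by omega)))
      gcongr
      linarith)
  calc ‖x‖ ^ k * ‖iteratedFDeriv ℝ m (fun x : RSpace n => Real.exp (-(‖x‖ ^ 2 / 2))) x‖
      ≤ (1 + ‖x‖) ^ k * (m.factorial * Real.exp (-(‖x‖ ^ 2 / 2)) *
          ((1 + C) * (1 + ‖x‖) ^ l) ^ m) := by
        refine mul_le_mul ?_ hcomp (norm_nonneg _) (by positivity)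
        gcongr
        linarith
    _ = m.factorial * (1 + C) ^ m *
          ((1 + ‖x‖) ^ (k + l * m) * Real.exp (-(‖x‖ ^ 2 / 2))) := by
        rw [mul_pow, ← pow_mul, pow_add]
        ring
    _ ≤ m.factorial * (1 + C) ^ m * C' := by
        gcongr
        exact hexp _ hx

/-- The Gaussian `exp (-|x|² / 2)` as a real Schwartz function. -/
noncomputable def realGaussian (n : ℕ) : 𝓢(RSpace n, ℝ) where
  toFun x := Real.exp (-(‖x‖ ^ 2 / 2))
  smooth' := by
    have : ContDiff ℝ ((⊤ : ℕ∞) : WithTop ℕ∞) fun x : RSpace n => ‖x‖ ^ 2 := contDiff_norm_sq ℝ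
    exact Real.contDiff_exp.comp (this.div_const 2).neg
  decay' := gaussian_decay

/-- The Gaussian `exp (-|x|² / 2)` as a complex Schwartz function. -/
noncomputable def gaussian (n : ℕ) : 𝓢(RSpace n, ℂ) :=
  SchwartzMap.postcompCLM Complex.ofRealCLM (realGaussian n)

theorem gaussian_apply (x : RSpace n) :
    gaussian n x = ((Real.exp (-(‖x‖ ^ 2 / 2)) : ℝ) : ℂ) := rfl

theorem derOp_gaussian (i : Fin n) : derOp i (gaussian n) = -posOp i (gaussian n) := by
  ext x
  have h1 : HasFDerivAt (fun x : RSpace n => ‖x‖ ^ 2) (2 • innerSL ℝ x) x :=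
    (hasStrictFDerivAt_norm_sq x).hasFDerivAt
  have h2 : HasFDerivAt (fun x : RSpace n => Real.exp (-(2⁻¹ * ‖x‖ ^ 2)))
      (Real.exp (-(2⁻¹ * ‖x‖ ^ 2)) • -((2⁻¹ : ℝ) • (2 • innerSL ℝ x : RSpace n →L[ℝ] ℝ))) x :=
    ((h1.const_mul (2⁻¹ : ℝ)).neg).exp
  have h3 : (gaussian n : RSpace n → ℂ) =
      fun x => Complex.ofRealCLM (Real.exp (-(2⁻¹ * ‖x‖ ^ 2))) := by
    ext x
    rw [gaussian_apply, div_eq_inv_mul]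
    rfl
  have h4 := Complex.ofRealCLM.hasFDerivAt.comp x h2
  rw [derOp_apply, h3]
  rw [Function.comp_def] at h4
  rw [h4.fderiv, neg_apply, posOp_apply, gaussian_apply, div_eq_inv_mul]
  simp [EuclideanSpace.inner_single_right]
  ring

end Gaussian

/-! ### Hermite spaces and ladder operators -/

section Hermite

variable {n : ℕ}

/-- The creation operator `x i - ∂ i`. -/
noncomputable def creOp (i : Fin n) : 𝓢(RSpace n, ℂ) →ₗ[ℂ] 𝓢(RSpace n, ℂ) := posOp i - derOp i

/-- The annihilation operator `x i + ∂ i`. -/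
noncomputable def annOp (i : Fin n) : 𝓢(RSpace n, ℂ) →ₗ[ℂ] 𝓢(RSpace n, ℂ) := posOp i + derOp i

theorem annOp_gaussian (i : Fin n) : annOp i (gaussian n) = 0 := by
  simp [annOp, derOp_gaussian]

theorem annOp_creOp (i k : Fin n) (φ : 𝓢(RSpace n, ℂ)) :
    annOp i (creOp k φ) = creOp k (annOp i φ) + (if i = k then (2 : ℂ) else 0) • φ := by
  simp only [annOp, creOp, LinearMap.add_apply, LinearMap.sub_apply, map_add, map_sub,
    derOp_posOp, posOp_posOp i k, derOp_derOp i k]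
  rcases eq_or_ne i k with rfl | h
  · simp only [if_true]
    module
  · simp [h, h.symm]
    abel

/-- Normal ordering of the harmonic oscillator: each term lowers the degree and then raises it,
whence the invariance of the Hermite spaces. -/
theorem sumSqOp_phaseOp (φ : 𝓢(RSpace n, ℂ)) :
    sumSqOp phaseOp φ = ∑ i, creOp i (annOp i φ) + (n : ℂ) • φ := by
  have h : ∀ i, creOp i (annOp i φ) = posOp i (posOp i φ) - derOp i (derOp i φ) - φ := by
    intro i
    simp only [annOp, creOp, LinearMap.add_apply, LinearMap.sub_apply, map_add, derOp_posOp]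
    simp only [if_true]
    module
  have h2 : ∀ i, phaseOp (Sum.inr i) (phaseOp (Sum.inr i) φ) = -derOp i (derOp i φ) := by
    intro i
    simp only [phaseOp_inr, LinearMap.smul_apply, map_smul, smul_smul]
    simp
  rw [sumSqOp_apply, Fintype.sum_sum_type]
  simp_rw [h, h2, phaseOp_inl, Finset.sum_sub_distrib, Finset.sum_neg_distrib]
  simp [← Nat.cast_smul_eq_nsmul ℂ]
  abel

/-- The span of the Hermite functions of degree less than `N`. -/
noncomputable def hermiteSpace (n : ℕ) : ℕ → Submodule ℂ 𝓢(RSpace n, ℂ)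
  | 0 => ⊥
  | N + 1 => Submodule.span ℂ {gaussian n} ⊔ ⨆ i, (hermiteSpace n N).map (creOp i)

theorem finiteDimensional_hermiteSpace (N : ℕ) : FiniteDimensional ℂ (hermiteSpace n N) := by
  induction N with
  | zero => rw [hermiteSpace]; infer_instance
  | succ N ih => rw [hermiteSpace]; infer_instance

theorem hermiteSpace_mono : Monotone (hermiteSpace n) := by
  refine monotone_nat_of_le_succ fun N => ?_
  induction N with
  | zero => rw [hermiteSpace]; exact bot_le
  | succ N ih =>
    rw [hermiteSpace, hermiteSpace]
    exact sup_le_sup_left (iSup_mono fun i => Submodule.map_mono ih) _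

theorem gaussian_mem_hermiteSpace (N : ℕ) : gaussian n ∈ hermiteSpace n (N + 1) := by
  rw [hermiteSpace]
  exact Submodule.mem_sup_left (Submodule.mem_span_singleton_self _)

theorem creOp_mem_hermiteSpace (i : Fin n) {N : ℕ} {φ : 𝓢(RSpace n, ℂ)}
    (hφ : φ ∈ hermiteSpace n N) : creOp i φ ∈ hermiteSpace n (N + 1) := by
  rw [hermiteSpace]
  exact Submodule.mem_sup_right
    (Submodule.mem_iSup_of_mem i (Submodule.mem_map_of_mem hφ))

/-- The annihilation operator is commuted past the creation operators until it reaches the Gaussian,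
which it kills; each commutator costs one creation operator. -/
theorem annOp_mem_hermiteSpace (i : Fin n) {N : ℕ} {φ : 𝓢(RSpace n, ℂ)}
    (hφ : φ ∈ hermiteSpace n (N + 1)) : annOp i φ ∈ hermiteSpace n N := by
  induction N generalizing φ with
  | zero =>
    suffices h : hermiteSpace n (0 + 1) ≤ (hermiteSpace n 0).comap (annOp i) from h hφ
    rw [hermiteSpace]
    refine sup_le ?_ (iSup_le fun k => ?_)
    · rw [Submodule.span_singleton_le_iff_mem, Submodule.mem_comap, annOp_gaussian]
      exact zero_mem _
    · rw [hermiteSpace, Submodule.map_bot]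
      exact bot_le
  | succ N ih =>
    suffices h : hermiteSpace n (N + 1 + 1) ≤ (hermiteSpace n (N + 1)).comap (annOp i) from h hφ
    rw [hermiteSpace]
    refine sup_le ?_ (iSup_le fun k => ?_)
    · rw [Submodule.span_singleton_le_iff_mem, Submodule.mem_comap, annOp_gaussian]
      exact zero_mem _
    · rintro _ ⟨ψ, hψ, rfl⟩
      rw [Submodule.mem_comap, annOp_creOp]
      exact add_mem (creOp_mem_hermiteSpace k (ih hψ)) (Submodule.smul_mem _ _ hψ)

theorem sumSqOp_mem_hermiteSpace {N : ℕ} {φ : 𝓢(RSpace n, ℂ)} (hφ : φ ∈ hermiteSpace n N) :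
    sumSqOp phaseOp φ ∈ hermiteSpace n N := by
  cases N with
  | zero =>
    rw [hermiteSpace, Submodule.mem_bot] at hφ
    rw [hφ, map_zero]
    exact zero_mem _
  | succ N =>
    rw [sumSqOp_phaseOp]
    exact add_mem (sum_mem fun i _ => creOp_mem_hermiteSpace i (annOp_mem_hermiteSpace i hφ))
      (Submodule.smul_mem _ _ hφ)

theorem posOp_mem_hermiteSpace (i : Fin n) {N : ℕ} {φ : 𝓢(RSpace n, ℂ)}
    (hφ : φ ∈ hermiteSpace n N) : posOp i φ ∈ hermiteSpace n (N + 1) := by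
  have h1 : annOp i φ ∈ hermiteSpace n (N + 1) :=
    hermiteSpace_mono (Nat.le_succ N)
      (annOp_mem_hermiteSpace i (hermiteSpace_mono (Nat.le_succ N) hφ))
  have h2 : posOp i φ = (2⁻¹ : ℂ) • (creOp i φ + annOp i φ) := by
    simp only [annOp, creOp, LinearMap.add_apply, LinearMap.sub_apply]
    module
  rw [h2]
  exact Submodule.smul_mem _ _ (add_mem (creOp_mem_hermiteSpace i hφ) h1)

/-- Orthogonality to the Hermite spaces thereby becomes vanishing of all directional moments against
the Gaussian. -/
theorem exists_inner_pow_mul_gaussian (ξ : RSpace n) (k : ℕ) :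
    ∃ φ ∈ hermiteSpace n (k + 1), ∀ x, φ x = ((inner ℝ x ξ ^ k : ℝ) : ℂ) * gaussian n x := by
  induction k with
  | zero => exact ⟨gaussian n, gaussian_mem_hermiteSpace 0, by simp⟩
  | succ k ih =>
    obtain ⟨φ, hφ, hval⟩ := ih
    refine ⟨∑ i, (ξ i : ℂ) • posOp i φ,
      sum_mem fun i _ => Submodule.smul_mem _ _ (posOp_mem_hermiteSpace i hφ), fun x => ?_⟩
    rw [sum_apply]
    simp only [smul_apply, posOp_apply, hval, smul_eq_mul]
    rw [pow_succ']
    have : inner ℝ x ξ = ∑ i, ξ i * x i := by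
      simp [PiLp.inner_apply]
    rw [this]
    push_cast
    rw [Finset.sum_mul, Finset.sum_mul]
    exact Finset.sum_congr rfl fun i _ => by ring

end Hermite

/-! ### Totality of the Hermite functions -/

section HermiteDensity

variable {n : ℕ}

open scoped FourierTransform

theorem inner_toL2_left (φ : 𝓢(RSpace n, ℂ)) (f : L2 n) :
    inner ℂ (toL2 φ) f = ∫ x, (starRingEnd ℂ) (φ x) * f x := by
  rw [L2.inner_def]
  refine integral_congr_ae ?_
  filter_upwards [coeFn_toL2 φ] with x hx
  rw [RCLike.inner_apply, hx, mul_comm]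

/-- An integrable function with vanishing Fourier transform vanishes. -/
theorem ae_eq_zero_of_fourier_eq_zero {G : RSpace n → ℂ} (hG : Integrable G)
    (h : ∀ ξ, 𝓕 G ξ = 0) : G =ᵐ[volume] 0 := by
  refine ae_eq_zero_of_integral_contDiff_smul_eq_zero hG.locallyIntegrable fun g hg hc => ?_
  have hg₁ : HasCompactSupport (Complex.ofRealCLM ∘ g) := hc.comp_left rfl
  have hg₂ := Complex.ofRealCLM.contDiff.comp hg
  set χ : 𝓢(RSpace n, ℂ) := hg₁.toSchwartzMap hg₂ with hχ
  -- The transform is moved from `G` to `𝓕⁻ χ`, so the integral of `G χ` equals one containing `𝓕 G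
  -- = 0`.
  have hflip := VectorFourier.integral_fourierIntegral_smul_eq_flip (μ := volume) (ν := volume)
    (L := innerₗ (RSpace n)) (f := G) (g := (𝓕⁻ χ : 𝓢(RSpace n, ℂ)))
    Real.continuous_fourierChar continuous_inner hG (𝓕⁻ χ : 𝓢(RSpace n, ℂ)).integrable
  rw [flip_innerₗ] at hflip
  have hl : ∀ ξ, VectorFourier.fourierIntegral Real.fourierChar volume (innerₗ (RSpace n)) G ξ = 0 := h
  have hr : VectorFourier.fourierIntegral Real.fourierChar volume (innerₗ (RSpace n))
      (𝓕⁻ χ : 𝓢(RSpace n, ℂ)) = χ := by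
    have h1 : 𝓕 (𝓕⁻ χ) = χ := FourierTransform.fourier_fourierInv_eq χ
    have h2 := fourier_coe (𝓕⁻ χ)
    rw [h1] at h2
    exact h2.symm
  rw [hr] at hflip
  simp only [hl, zero_smul, integral_zero] at hflip
  rw [hflip]
  refine integral_congr_ae (Filter.Eventually.of_forall fun x => ?_)
  change g x • G x = G x • ((g x : ℝ) : ℂ)
  rw [Complex.real_smul, smul_eq_mul, mul_comm]

/-- The function `exp (-|x|² / 4)` is square integrable. -/
theorem memLp_exp_neg_norm_sq :
    MemLp (fun x : RSpace n => Real.exp (-(‖x‖ ^ 2 / 4))) 2 volume := by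
  have hcont : Continuous fun x : RSpace n => Real.exp (-(‖x‖ ^ 2 / 4)) := by fun_prop
  rw [memLp_two_iff_integrable_sq hcont.aestronglyMeasurable]
  have h := (realGaussian n).integrable (μ := volume)
  refine h.congr (Filter.Eventually.of_forall fun x => ?_)
  change Real.exp (-(‖x‖ ^ 2 / 2)) = Real.exp (-(‖x‖ ^ 2 / 4)) ^ 2
  rw [← Real.exp_nat_mul]
  congr 1
  push_cast
  ring

theorem exp_abs_inner_mul_gaussian_le (x ξ : RSpace n) :
    Real.exp |inner ℝ x ξ| * Real.exp (-(‖x‖ ^ 2 / 2)) ≤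
      Real.exp (‖ξ‖ ^ 2) * Real.exp (-(‖x‖ ^ 2 / 4)) := by
  rw [← Real.exp_add, ← Real.exp_add]
  refine Real.exp_le_exp.2 ?_
  have := abs_real_inner_le_norm x ξ
  nlinarith [sq_nonneg (‖x‖ / 2 - ‖ξ‖)]

/-- The Hermite functions are total in `L²`. -/
theorem eq_zero_of_inner_hermiteSpace_eq_zero (f : L2 n)
    (h : ∀ N, ∀ φ ∈ hermiteSpace n N, inner ℂ (toL2 φ) f = 0) : f = 0 := by
  have hfm : AEStronglyMeasurable (f : RSpace n → ℂ) volume := Lp.aestronglyMeasurable f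
  have hgm : Continuous (gaussian n) := (gaussian n).continuous
  have hmom : ∀ (ξ : RSpace n) (k : ℕ),
      ∫ x, ((inner ℝ x ξ ^ k : ℝ) : ℂ) * (gaussian n x * f x) = 0 := by
    intro ξ k
    obtain ⟨φ, hφ, hval⟩ := exists_inner_pow_mul_gaussian ξ k
    rw [← h _ φ hφ, inner_toL2_left]
    refine integral_congr_ae (Filter.Eventually.of_forall fun x => ?_)
    simp only [hval, gaussian_apply, ← Complex.ofReal_mul, Complex.conj_ofReal]
    push_cast
    ring
  have hint : Integrable fun x => Real.exp (-(‖x‖ ^ 2 / 4)) * ‖f x‖ :=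
    memLp_exp_neg_norm_sq.integrable_mul (Lp.memLp f).norm
  have hgnorm : ∀ x, ‖gaussian n x‖ = Real.exp (-(‖x‖ ^ 2 / 2)) := fun x => by
    rw [gaussian_apply, Complex.norm_real, Real.norm_of_nonneg (Real.exp_pos _).le]
  have hdom : ∀ ξ : RSpace n,
      Integrable fun x => Real.exp |inner ℝ x ξ| * ‖gaussian n x * f x‖ := by
    intro ξ
    refine (hint.const_mul (Real.exp (‖ξ‖ ^ 2))).mono'
      (AEStronglyMeasurable.mul (Continuous.aestronglyMeasurable (by fun_prop))
        (hgm.aestronglyMeasurable.mul hfm).norm)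
      (Filter.Eventually.of_forall fun x => ?_)
    rw [Real.norm_of_nonneg (by positivity), norm_mul, hgnorm, ← mul_assoc, ← mul_assoc]
    exact mul_le_mul_of_nonneg_right (exp_abs_inner_mul_gaussian_le x ξ) (norm_nonneg _)
  have hG : Integrable fun x => gaussian n x * f x := by
    refine (hdom 0).mono' (hgm.aestronglyMeasurable.mul hfm)
      (Filter.Eventually.of_forall fun x => ?_)
    simp
  -- Expanding the exponential in its power series turns the Fourier transform into a series of
  -- vanishing moments; `hdom` justifies the termwise integration.
  have hF : ∀ ξ, 𝓕 (fun x => gaussian n x * f x) ξ = 0 := by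
    intro ξ
    rw [Real.fourier_eq']
    have hin : ∀ x : RSpace n, -2 * Real.pi * inner ℝ x ξ =
        inner ℝ x ((-2 * Real.pi) • ξ) := fun x => by rw [inner_smul_right]
    simp_rw [hin]
    set η := (-2 * Real.pi) • ξ
    have hsum := hasSum_integral_of_dominated_convergence (μ := volume)
      (F := fun (k : ℕ) x => ((inner ℝ x η : ℝ) * Complex.I) ^ k / (k.factorial : ℂ) *
        (gaussian n x * f x))
      (f := fun x => Complex.exp ((inner ℝ x η : ℝ) * Complex.I) • (gaussian n x * f x))
      (fun k x => |inner ℝ x η| ^ k / k.factorial * ‖gaussian n x * f x‖)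
      (fun k => AEStronglyMeasurable.mul (Continuous.aestronglyMeasurable (by fun_prop))
        (hgm.aestronglyMeasurable.mul hfm))
      (fun k => Filter.Eventually.of_forall fun x => by
        rw [norm_mul, norm_div, norm_pow, norm_mul, Complex.norm_I, Complex.norm_real, mul_one,
          Complex.norm_natCast, Real.norm_eq_abs])
      (Filter.Eventually.of_forall fun x =>
        (Real.summable_pow_div_factorial _).mul_right _)
      ((hdom η).congr (Filter.Eventually.of_forall fun x => by
        simp only [tsum_mul_right, Real.exp_eq_exp_ℝ, NormedSpace.exp_eq_tsum_div]))
      (Filter.Eventually.of_forall fun x => by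
        have := NormedSpace.expSeries_div_hasSum_exp (((inner ℝ x η : ℝ) : ℂ) * Complex.I)
        rw [← Complex.exp_eq_exp_ℂ] at this
        exact this.mul_right _)
    refine hsum.unique ?_
    have hrw : ∀ (k : ℕ) (x : RSpace n), ((inner ℝ x η : ℝ) * Complex.I) ^ k / (k.factorial : ℂ) *
        (gaussian n x * f x) = Complex.I ^ k / (k.factorial : ℂ) *
          (((inner ℝ x η ^ k : ℝ) : ℂ) * (gaussian n x * f x)) := fun k x => by
      push_cast
      ring
    simp_rw [hrw, integral_const_mul, hmom, mul_zero]
    exact hasSum_zero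
  have h0 := ae_eq_zero_of_fourier_eq_zero hG hF
  rw [Lp.eq_zero_iff_ae_eq_zero]
  filter_upwards [h0] with x hx
  have hg : gaussian n x ≠ 0 := by
    rw [gaussian_apply]
    exact_mod_cast (Real.exp_pos _).ne'
  exact (mul_eq_zero.1 hx).resolve_left hg

end HermiteDensity

/-! ### The Weyl integral of a quadratic symbol -/

section WeylFormula

variable {n : ℕ}

open scoped FourierTransform

/-- The partial Fourier integral `∫ exp (i (x - y)·ξ) u(y) dy`. -/
noncomputable def osc (x ξ : RSpace n) : 𝓢(RSpace n, ℂ) →ₗ[ℂ] ℂ where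
  toFun u := Complex.exp (Complex.I * ((inner ℝ x ξ : ℝ) : ℂ)) * (𝓕 u) ((2 * Real.pi)⁻¹ • ξ)
  map_add' u v := by
    rw [FourierTransform.fourier_add, add_apply, mul_add]
  map_smul' c u := by
    rw [FourierTransform.fourier_smul, smul_apply, smul_eq_mul, RingHom.id_apply, smul_eq_mul]
    ring

theorem osc_apply (x ξ : RSpace n) (u : 𝓢(RSpace n, ℂ)) :
    osc x ξ u = Complex.exp (Complex.I * ((inner ℝ x ξ : ℝ) : ℂ)) *
      (𝓕 u) ((2 * Real.pi)⁻¹ • ξ) := rfl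

theorem osc_eq_integral (x ξ : RSpace n) (u : 𝓢(RSpace n, ℂ)) :
    osc x ξ u = ∫ y, Complex.exp (Complex.I * ((inner ℝ (x - y) ξ : ℝ) : ℂ)) * u y := by
  rw [osc_apply, fourier_coe, Real.fourier_eq', ← integral_const_mul]
  congr 1
  ext y
  rw [smul_eq_mul, ← mul_assoc, ← Complex.exp_add, inner_smul_right, inner_sub_left]
  congr 2
  have hpi : (Real.pi : ℂ) ≠ 0 := by exact_mod_cast Real.pi_ne_zero
  push_cast
  field_simp
  ring

/-- Fourier inversion after the substitution `ξ = 2π η`, whose Jacobian cancels the prefactor. -/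
theorem integral_osc (x : RSpace n) (u : 𝓢(RSpace n, ℂ)) :
    ((2 * Real.pi : ℝ) : ℂ)⁻¹ ^ n * ∫ ξ, osc x ξ u = u x := by
  have hpi : (0 : ℝ) < 2 * Real.pi := by positivity
  have h1 : ∫ ξ, osc x ξ u = |(2 * Real.pi) ^ Module.finrank ℝ (RSpace n)| • ∫ η : RSpace n,
      Complex.exp (((2 * Real.pi * inner ℝ η x : ℝ) : ℂ) * Complex.I) • (𝓕 u) η := by
    rw [← Measure.integral_comp_inv_smul]
    congr 1
    ext ξ
    simp only [osc_apply, smul_eq_mul, inner_smul_left, real_inner_comm ξ x]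
    congr 2
    simp only [conj_trivial]
    rw [← mul_assoc, mul_inv_cancel₀ hpi.ne', one_mul, mul_comm]
  rw [h1, ← Real.fourierInv_eq']
  have h2 : 𝓕⁻ ((𝓕 u : 𝓢(RSpace n, ℂ)) : RSpace n → ℂ) x = u x := by
    rw [← fourierInv_coe, FourierTransform.fourierInv_fourier_eq]
  rw [h2, finrank_euclideanSpace_fin, abs_of_pos (by positivity), Complex.real_smul]
  push_cast
  rw [← mul_assoc, ← mul_pow, inv_mul_cancel₀ (by simp [Real.pi_ne_zero]), one_pow, one_mul]

/-- Integration by parts in `y`: a factor `ξ i` is traded for `D i` acting on `u`, which removes the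
polynomial in `ξ` before inversion. -/
theorem osc_momentum (x ξ : RSpace n) (i : Fin n) (u : 𝓢(RSpace n, ℂ)) :
    osc x ξ (phaseOp (Sum.inr i) u) = (ξ i : ℂ) * osc x ξ u := by
  have htg : (fun y : RSpace n => inner ℝ y (EuclideanSpace.single i (1 : ℝ))).HasTemperateGrowth := by
    fun_prop
  have hpi : (Real.pi : ℂ) ≠ 0 := by exact_mod_cast Real.pi_ne_zero
  rw [phaseOp_inr, LinearMap.smul_apply, map_smul, derOp_eq, osc_apply, fourier_lineDerivOp_eq,
    smul_apply, smulLeftCLM_apply_apply htg, osc_apply]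
  simp only [EuclideanSpace.inner_single_right, smul_eq_mul, Complex.real_smul]
  simp
  field_simp
  ring_nf
  simp

/-- Coordinates on phase space. -/
def phaseCoord (X : RSpace n × RSpace n) : Fin n ⊕ Fin n → ℝ := Sum.elim X.1 X.2

/-- Multiplication by `(x i + y i) / 2` in the variable `y`. -/
noncomputable def midOp (x : RSpace n) (i : Fin n) : 𝓢(RSpace n, ℂ) →ₗ[ℂ] 𝓢(RSpace n, ℂ) :=
  (2⁻¹ : ℂ) • ((x i : ℂ) • LinearMap.id + posOp i)

theorem midOp_apply (x : RSpace n) (i : Fin n) (u : 𝓢(RSpace n, ℂ)) :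
    midOp x i u = (2⁻¹ : ℂ) • ((x i : ℂ) • u + posOp i u) := rfl

theorem midOp_apply_apply (x : RSpace n) (i : Fin n) (u : 𝓢(RSpace n, ℂ)) (y : RSpace n) :
    midOp x i u y = (((2⁻¹ : ℝ) • (x + y)) i : ℝ) * u y := by
  rw [midOp_apply, smul_apply, add_apply, smul_apply, posOp_apply]
  simp
  ring

/-- A product of two phase space coordinates at the midpoint, times a Schwartz function, has the
same oscillatory integral as a Schwartz function independent of `ξ`. -/
theorem exists_osc_eq (x : RSpace n) (u : 𝓢(RSpace n, ℂ)) (a b : Fin n ⊕ Fin n) :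
    ∃ W : 𝓢(RSpace n, ℂ),
      W x = 2⁻¹ * (phaseOp a (phaseOp b u) x + phaseOp b (phaseOp a u) x) ∧
      ∀ ξ : RSpace n, ∃ V : 𝓢(RSpace n, ℂ), osc x ξ V = osc x ξ W ∧ ∀ y, V y =
        ((phaseCoord ((2⁻¹ : ℝ) • (x + y), ξ) a * phaseCoord ((2⁻¹ : ℝ) • (x + y), ξ) b : ℝ) : ℂ)
          * u y := by
  have hmix : ∀ (i k : Fin n), ∃ W : 𝓢(RSpace n, ℂ),
      W x = 2⁻¹ * (phaseOp (Sum.inl i) (phaseOp (Sum.inr k) u) x +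
        phaseOp (Sum.inr k) (phaseOp (Sum.inl i) u) x) ∧
      ∀ ξ : RSpace n, ∃ V : 𝓢(RSpace n, ℂ), osc x ξ V = osc x ξ W ∧ ∀ y, V y =
        (((((2⁻¹ : ℝ) • (x + y)) i : ℝ) * ξ k : ℝ) : ℂ) * u y := by
    intro i k
    -- Trading `ξ k` for `D k` gives `D k ((x i + y i) / 2 · u)`; at `y = x` this is half of `x i D
    -- k u + D k (x i u)`, the symmetric ordering.
    refine ⟨phaseOp (Sum.inr k) (midOp x i u), ?_, fun ξ => ⟨(ξ k : ℂ) • midOp x i u, ?_, ?_⟩⟩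
    · rw [midOp_apply, map_smul, map_add, map_smul, smul_apply, add_apply, smul_apply, phaseOp_inl,
        posOp_apply, smul_eq_mul, smul_eq_mul]
    · rw [osc_momentum, map_smul, smul_eq_mul]
    · intro y
      rw [smul_apply, midOp_apply_apply, smul_eq_mul]
      push_cast
      ring
  rcases a with i | i <;> rcases b with k | k
  · refine ⟨midOp x i (midOp x k u), ?_, fun ξ => ⟨midOp x i (midOp x k u), rfl, fun y => ?_⟩⟩
    · simp only [midOp_apply_apply, phaseOp_inl, posOp_apply]
      simp
      ring
    · simp only [midOp_apply_apply, phaseCoord, Sum.elim_inl]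
      push_cast
      ring
  · exact hmix i k
  · obtain ⟨W, hW, hV⟩ := hmix k i
    refine ⟨W, by rw [hW, add_comm], fun ξ => ?_⟩
    obtain ⟨V, h1, h2⟩ := hV ξ
    refine ⟨V, h1, fun y => ?_⟩
    rw [h2, mul_comm (_ : ℝ) (ξ i)]
    rfl
  · refine ⟨phaseOp (Sum.inr i) (phaseOp (Sum.inr k) u), ?_, fun ξ =>
      ⟨((ξ i : ℂ) * (ξ k : ℂ)) • u, ?_, fun y => ?_⟩⟩
    · rw [phaseOp_comm (Sum.inr k) (Sum.inr i)]
      simp only [phaseComm, zero_smul, add_zero]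
      ring
    · rw [osc_momentum, osc_momentum, map_smul, smul_eq_mul, mul_assoc]
    · simp [phaseCoord]

/-- The Weyl quantization of a quadratic symbol on Schwartz functions. -/
theorem weylSchwartz_eq_quadOp {a : RSpace n × RSpace n → ℂ}
    {m : Fin n ⊕ Fin n → Fin n ⊕ Fin n → ℂ} (hm : ∀ i k, m i k = m k i)
    (ha : ∀ X, a X = quadForm m (phaseCoord X)) (u : 𝓢(RSpace n, ℂ)) (x : RSpace n) :
    weylSchwartz a u x = quadOp m phaseOp u x := by
  choose W hW hV using exists_osc_eq x u
  have hinner : ∀ ξ : RSpace n, (∫ y : RSpace n,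
      Complex.exp (Complex.I * ((inner ℝ (x - y) ξ : ℝ) : ℂ)) *
        a ((2⁻¹ : ℝ) • (x + y), ξ) * u y) = osc x ξ (∑ i, ∑ k, m i k • W i k) := by
    intro ξ
    choose V hV1 hV2 using fun i k => hV i k ξ
    have h1 : osc x ξ (∑ i, ∑ k, m i k • W i k) = osc x ξ (∑ i, ∑ k, m i k • V i k) := by
      simp only [map_sum, map_smul, hV1]
    rw [h1, osc_eq_integral]
    congr 1
    ext y
    rw [mul_assoc]
    congr 1
    rw [ha, quadForm, sum_apply, Finset.sum_mul]
    refine Finset.sum_congr rfl fun i _ => ?_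
    rw [sum_apply, Finset.sum_mul]
    refine Finset.sum_congr rfl fun k _ => ?_
    rw [smul_apply, hV2, smul_eq_mul, mul_assoc]
  rw [weylSchwartz]
  simp_rw [hinner]
  rw [integral_osc, quadOp_apply]
  simp only [sum_apply, smul_apply, hW, smul_eq_mul]
  have hswap : ∑ i, ∑ k, m i k * phaseOp k (phaseOp i u) x =
      ∑ i, ∑ k, m i k * phaseOp i (phaseOp k u) x := by
    rw [Finset.sum_comm]
    exact Finset.sum_congr rfl fun i _ => Finset.sum_congr rfl fun k _ => by rw [hm]
  simp_rw [mul_left_comm _ (2⁻¹ : ℂ), mul_add, Finset.sum_add_distrib, ← Finset.mul_sum]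
  rw [hswap]
  ring

end WeylFormula

/-! ### Coefficients of the symbol -/

section SymbolCoeff

variable {n : ℕ}

/-- The coordinate vectors of phase space. -/
noncomputable def phaseBasis : Fin n ⊕ Fin n → RSpace n × RSpace n :=
  Sum.elim (fun i => (EuclideanSpace.single i 1, 0)) fun i => (0, EuclideanSpace.single i 1)

/-- The coefficients of a quadratic form on phase space. -/
noncomputable def symbolCoeff (q : QuadraticMap ℝ (RSpace n × RSpace n) ℂ)
    (a b : Fin n ⊕ Fin n) : ℂ :=
  QuadraticMap.associated (R := ℝ) q (phaseBasis a) (phaseBasis b)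

theorem symbolCoeff_symm (q : QuadraticMap ℝ (RSpace n × RSpace n) ℂ) (a b : Fin n ⊕ Fin n) :
    symbolCoeff q a b = symbolCoeff q b a := by
  simp only [symbolCoeff, QuadraticMap.associated_apply]
  rw [add_comm (phaseBasis a), sub_right_comm]

theorem sum_phaseCoord_smul (X : RSpace n × RSpace n) :
    ∑ a, phaseCoord X a • phaseBasis a = X := by
  rw [Fintype.sum_sum_type]
  ext i <;> simp [phaseCoord, phaseBasis, Prod.fst_sum, Prod.snd_sum, Pi.single_apply]

theorem apply_eq_quadForm (q : QuadraticMap ℝ (RSpace n × RSpace n) ℂ) (X : RSpace n × RSpace n) :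
    q X = quadForm (symbolCoeff q) (phaseCoord X) := by
  conv_lhs => rw [← QuadraticMap.associated_eq_self_apply ℝ q X, ← sum_phaseCoord_smul X]
  simp only [map_sum, map_smul, LinearMap.sum_apply, LinearMap.smul_apply, quadForm, symbolCoeff,
    Complex.real_smul, Finset.smul_sum]
  refine Finset.sum_congr rfl fun a _ => Finset.sum_congr rfl fun b _ => ?_
  have := QuadraticMap.associated_isSymm ℝ q (phaseBasis b) (phaseBasis a)
  push_cast
  linear_combination ((phaseCoord X a : ℂ) * phaseCoord X b) * this

theorem phaseCoord_surjective : Function.Surjective (phaseCoord (n := n)) := fun v =>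
  ⟨(WithLp.toLp 2 fun i => v (Sum.inl i), WithLp.toLp 2 fun i => v (Sum.inr i)), by
    ext (i | i) <;> rfl⟩

theorem quadForm_mem_range (q : QuadraticMap ℝ (RSpace n × RSpace n) ℂ) (v : Fin n ⊕ Fin n → ℝ) :
    quadForm (symbolCoeff q) v ∈ Set.range q := by
  obtain ⟨X, rfl⟩ := phaseCoord_surjective v
  exact ⟨X, apply_eq_quadForm q X⟩

/-- The product carries the maximum norm, hence the factor `2`, which later halves the coercivity
constant. -/
theorem sum_phaseCoord_sq_le (X : RSpace n × RSpace n) :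
    ∑ a, phaseCoord X a ^ 2 ≤ 2 * ‖X‖ ^ 2 := by
  have h1 : ∑ a, phaseCoord X a ^ 2 = ‖X.1‖ ^ 2 + ‖X.2‖ ^ 2 := by
    rw [Fintype.sum_sum_type, EuclideanSpace.real_norm_sq_eq, EuclideanSpace.real_norm_sq_eq]
    rfl
  have h2 : ‖X.1‖ ^ 2 ≤ ‖X‖ ^ 2 := by gcongr; exact norm_fst_le X
  have h3 : ‖X.2‖ ^ 2 ≤ ‖X‖ ^ 2 := by gcongr; exact norm_snd_le X
  linarith

end SymbolCoeff

/-! ### Bilinear pairing and transposes -/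

section Pairing

variable {n : ℕ}

/-- The bilinear pairing `∫ u ψ` of square integrable functions with Schwartz functions. -/
noncomputable def l2Pair : L2 n →ₗ[ℂ] 𝓢(RSpace n, ℂ) →ₗ[ℂ] ℂ :=
  LinearMap.mk₂ ℂ
    (fun u ψ => Lp.toTemperedDistributionCLM ℂ (volume : Measure (RSpace n)) 2 u ψ)
    (fun u v ψ => by rw [map_add]; rfl) (fun c u ψ => by rw [map_smul]; rfl)
    (fun u ψ χ => map_add _ ψ χ) (fun c u ψ => map_smul _ c ψ)

theorem l2Pair_eq (u : L2 n) (ψ : 𝓢(RSpace n, ℂ)) :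
    l2Pair u ψ = Lp.toTemperedDistributionCLM ℂ (volume : Measure (RSpace n)) 2 u ψ := rfl

theorem l2Pair_apply (u : L2 n) (ψ : 𝓢(RSpace n, ℂ)) : l2Pair u ψ = ∫ x, u x * ψ x := by
  rw [l2Pair_eq, Lp.toTemperedDistributionCLM_apply, Lp.toTemperedDistribution_apply]
  simp only [smul_eq_mul, mul_comm]

theorem l2Pair_injective {u v : L2 n} (h : ∀ ψ, l2Pair u ψ = l2Pair v ψ) : u = v := by
  refine LinearMap.ker_eq_bot.mp
    (Lp.ker_toTemperedDistributionCLM_eq_bot (F := ℂ) (μ := (volume : Measure (RSpace n)))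
      (p := 2)) ?_
  ext ψ
  exact h ψ

theorem l2Pair_toL2 (φ ψ : 𝓢(RSpace n, ℂ)) : l2Pair (toL2 φ) ψ = ∫ x, φ x * ψ x := by
  rw [l2Pair_apply]
  refine integral_congr_ae ?_
  filter_upwards [coeFn_toL2 φ] with x hx
  rw [hx]

/-- Translates between the bilinear pairing of distributions and the sesquilinear product in which
weak limits are taken. -/
theorem l2Pair_eq_inner_star_toL2 (u : L2 n) (ψ : 𝓢(RSpace n, ℂ)) :
    l2Pair u ψ = inner ℂ (star (toL2 ψ)) u := by
  rw [l2Pair_apply, L2.inner_def]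
  refine integral_congr_ae ?_
  filter_upwards [coeFn_toL2 ψ, Lp.coeFn_star (toL2 ψ)] with x hx hx'
  rw [RCLike.inner_apply, hx', Pi.star_apply, hx]
  simp

theorem l2Pair_eq_inner_star (u : L2 n) (ψ : 𝓢(RSpace n, ℂ)) :
    l2Pair u ψ = inner ℂ (star u) (toL2 ψ) := by
  rw [l2Pair_apply, L2.inner_def]
  refine integral_congr_ae ?_
  filter_upwards [coeFn_toL2 ψ, Lp.coeFn_star u] with x hx hx'
  rw [RCLike.inner_apply, hx', Pi.star_apply, hx, mul_comm]
  simp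

theorem l2Pair_phaseOp (a : Fin n ⊕ Fin n) (φ ψ : 𝓢(RSpace n, ℂ)) :
    l2Pair (toL2 φ) (phaseOp a ψ) = phaseSign a * l2Pair (toL2 (phaseOp a φ)) ψ := by
  rw [l2Pair_toL2, l2Pair_toL2, integral_phaseOp_mul, ← mul_assoc]
  rcases a with i | i <;> simp [phaseSign]

/-- The operators `M` on Schwartz functions whose transpose maps `u` to a square integrable
function. -/
noncomputable def repOps (u : L2 n) : Submodule ℂ (𝓢(RSpace n, ℂ) →ₗ[ℂ] 𝓢(RSpace n, ℂ)) where
  carrier := {M | ∃ v : L2 n, ∀ ψ, l2Pair v ψ = l2Pair u (M ψ)}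
  zero_mem' := ⟨0, by simp⟩
  add_mem' := by
    rintro M M' ⟨v, hv⟩ ⟨v', hv'⟩
    exact ⟨v + v', fun ψ => by simp [hv, hv']⟩
  smul_mem' := by
    rintro c M ⟨v, hv⟩
    exact ⟨c • v, fun ψ => by simp [hv]⟩

theorem mem_repOps {u : L2 n} {M : 𝓢(RSpace n, ℂ) →ₗ[ℂ] 𝓢(RSpace n, ℂ)} :
    M ∈ repOps u ↔ ∃ v : L2 n, ∀ ψ, l2Pair v ψ = l2Pair u (M ψ) := Iff.rfl

theorem id_mem_repOps (u : L2 n) : LinearMap.id ∈ repOps u := ⟨u, fun _ => rfl⟩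

end Pairing

/-! ### The domain `B` in terms of phase space operators -/

section Domain

variable {n : ℕ}

theorem mem_domainB_iff {u : L2 n} :
    u ∈ domainB n ↔ ∀ k l : ℕ, k + l ≤ 2 → ∀ (J : Fin k → Fin n) (K : Fin l → Fin n),
      ∃ v : L2 n, ∀ ψ, l2Pair v ψ =
        monomialOp J K (Lp.toTemperedDistributionCLM ℂ (volume : Measure (RSpace n)) 2 u) ψ := by
  simp only [domainB, Submodule.mem_iInf, Submodule.mem_comap, LinearMap.mem_range]
  refine forall₅_congr fun k l _ J K => exists_congr fun v => ?_
  constructor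
  · intro h ψ
    exact DFunLike.congr_fun h ψ
  · intro h
    ext ψ
    exact h ψ

theorem monomialOp_apply {k l : ℕ} (J : Fin k → Fin n) (K : Fin l → Fin n)
    (T : 𝓢'(RSpace n, ℂ)) (ψ : 𝓢(RSpace n, ℂ)) :
    monomialOp J K T ψ = (∂^{fun i => EuclideanSpace.single (K i) (1 : ℝ)} T : 𝓢'(RSpace n, ℂ))
      (SchwartzMap.smulLeftCLM ℂ (fun x : RSpace n => ∏ i, ((x (J i) : ℝ) : ℂ)) ψ) := rfl

theorem smulLeftCLM_prod_zero (J : Fin 0 → Fin n) (ψ : 𝓢(RSpace n, ℂ)) :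
    SchwartzMap.smulLeftCLM ℂ (fun x : RSpace n => ∏ i, ((x (J i) : ℝ) : ℂ)) ψ = ψ := by
  simp

theorem smulLeftCLM_prod_one (J : Fin 1 → Fin n) (ψ : 𝓢(RSpace n, ℂ)) :
    SchwartzMap.smulLeftCLM ℂ (fun x : RSpace n => ∏ i, ((x (J i) : ℝ) : ℂ)) ψ =
      posOp (J 0) ψ := by
  simp only [Fin.prod_univ_one]
  rfl

theorem smulLeftCLM_prod_two (J : Fin 2 → Fin n) (ψ : 𝓢(RSpace n, ℂ)) :
    SchwartzMap.smulLeftCLM ℂ (fun x : RSpace n => ∏ i, ((x (J i) : ℝ) : ℂ)) ψ =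
      posOp (J 0) (posOp (J 1) ψ) := by
  have htg : (fun x : RSpace n => ((x (J 0) : ℝ) : ℂ) * ((x (J 1) : ℝ) : ℂ)).HasTemperateGrowth :=
    (hasTemperateGrowth_coord (J 0)).mul (hasTemperateGrowth_coord (J 1))
  simp only [Fin.prod_univ_two]
  ext x
  rw [smulLeftCLM_apply_apply htg, posOp_apply, posOp_apply, smul_eq_mul, mul_assoc]

theorem iteratedLineDerivOp_apply_zero (K : Fin 0 → Fin n) (T : 𝓢'(RSpace n, ℂ))
    (ψ : 𝓢(RSpace n, ℂ)) :
    (∂^{fun i => EuclideanSpace.single (K i) (1 : ℝ)} T : 𝓢'(RSpace n, ℂ)) ψ = T ψ := rfl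

theorem iteratedLineDerivOp_apply_one (K : Fin 1 → Fin n) (T : 𝓢'(RSpace n, ℂ))
    (ψ : 𝓢(RSpace n, ℂ)) :
    (∂^{fun i => EuclideanSpace.single (K i) (1 : ℝ)} T : 𝓢'(RSpace n, ℂ)) ψ =
      -T (derOp (K 0) ψ) := by
  rw [LineDeriv.iteratedLineDerivOp_one, TemperedDistribution.lineDerivOp_apply_apply, map_neg]
  rfl

theorem iteratedLineDerivOp_apply_two (K : Fin 2 → Fin n) (T : 𝓢'(RSpace n, ℂ))
    (ψ : 𝓢(RSpace n, ℂ)) :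
    (∂^{fun i => EuclideanSpace.single (K i) (1 : ℝ)} T : 𝓢'(RSpace n, ℂ)) ψ =
      T (derOp (K 1) (derOp (K 0) ψ)) := by
  rw [LineDeriv.iteratedLineDerivOp_succ_left, TemperedDistribution.lineDerivOp_apply_apply,
    LineDeriv.iteratedLineDerivOp_one, TemperedDistribution.lineDerivOp_apply_apply,
    LineDeriv.lineDerivOp_neg, neg_neg]
  rfl

theorem derOp_eq_smul_phaseOp (i : Fin n) : derOp i = Complex.I • phaseOp (Sum.inr i) := by
  rw [phaseOp_inr, smul_smul]
  simp

/-- Second order operators map the domain into `L²`. -/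
theorem phaseOp_comp_mem_repOps {u : L2 n} (hu : u ∈ domainB n) (a b : Fin n ⊕ Fin n) :
    phaseOp a ∘ₗ phaseOp b ∈ repOps u := by
  rw [mem_domainB_iff] at hu
  -- The transpose of `x k ∂ i` sends `ψ` to `-∂ i (x k ψ)`, so the definition of `B` supplies this
  -- order only; the other follows from the scalar commutator.
  have hmix : ∀ i k : Fin n, phaseOp (Sum.inr i) ∘ₗ phaseOp (Sum.inl k) ∈ repOps u := by
    intro i k
    obtain ⟨v, hv⟩ := hu 1 1 le_rfl ![k] ![i]
    refine ⟨Complex.I • v, fun ψ => ?_⟩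
    rw [map_smul, LinearMap.smul_apply, hv, monomialOp_apply, iteratedLineDerivOp_apply_one,
      smulLeftCLM_prod_one, ← l2Pair_eq, phaseOp_inr]
    simp [phaseOp_inl]
  rcases a with i | i <;> rcases b with k | k
  · obtain ⟨v, hv⟩ := hu 2 0 le_rfl ![i, k] ![]
    refine ⟨v, fun ψ => ?_⟩
    rw [hv, monomialOp_apply, iteratedLineDerivOp_apply_zero, smulLeftCLM_prod_two]
    rfl
  · have h : phaseOp (Sum.inl i) ∘ₗ phaseOp (Sum.inr k) =
        phaseOp (Sum.inr k) ∘ₗ phaseOp (Sum.inl i) +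
          phaseComm (Sum.inl i) (Sum.inr k) • LinearMap.id := by
      ext1 φ
      exact phaseOp_comm _ _ φ
    rw [h]
    exact add_mem (hmix k i) (Submodule.smul_mem _ _ (id_mem_repOps u))
  · exact hmix i k
  · obtain ⟨v, hv⟩ := hu 0 2 le_rfl ![] ![k, i]
    refine ⟨-v, fun ψ => ?_⟩
    rw [map_neg, LinearMap.neg_apply, hv, monomialOp_apply, iteratedLineDerivOp_apply_two,
      smulLeftCLM_prod_zero, ← l2Pair_eq, phaseOp_inr, phaseOp_inr]
    simp only [LinearMap.comp_apply, LinearMap.smul_apply, map_smul, smul_smul]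
    simp

theorem quadOp_mem_repOps {u : L2 n} (hu : u ∈ domainB n) (m : Fin n ⊕ Fin n → Fin n ⊕ Fin n → ℂ) :
    quadOp m phaseOp ∈ repOps u :=
  sum_mem fun a _ => sum_mem fun b _ => Submodule.smul_mem _ _ (phaseOp_comp_mem_repOps hu a b)

/-- A sufficient condition for membership in the domain. -/
theorem mem_domainB_of_mem_repOps {u : L2 n} (h₁ : ∀ a, phaseOp a ∈ repOps u)
    (h₂ : ∀ a b, phaseOp a ∘ₗ phaseOp b ∈ repOps u) : u ∈ domainB n := by
  rw [mem_domainB_iff]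
  intro k l hkl J K
  suffices h : ∃ M ∈ repOps u, ∀ T : 𝓢'(RSpace n, ℂ), ∀ ψ, monomialOp J K T ψ = T (M ψ) by
    obtain ⟨M, ⟨v, hv⟩, hM⟩ := h
    exact ⟨v, fun ψ => by rw [hv, hM, l2Pair_eq]⟩
  have hder : ∀ i, derOp i ∈ repOps u := fun i => by
    rw [derOp_eq_smul_phaseOp]
    exact Submodule.smul_mem _ _ (h₁ _)
  have hcases : (k = 0 ∧ l = 0) ∨ (k = 1 ∧ l = 0) ∨ (k = 2 ∧ l = 0) ∨ (k = 0 ∧ l = 1) ∨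
      (k = 1 ∧ l = 1) ∨ (k = 0 ∧ l = 2) := by omega
  rcases hcases with ⟨rfl, rfl⟩ | ⟨rfl, rfl⟩ | ⟨rfl, rfl⟩ | ⟨rfl, rfl⟩ | ⟨rfl, rfl⟩ | ⟨rfl, rfl⟩
  · refine ⟨LinearMap.id, id_mem_repOps u, fun T ψ => ?_⟩
    rw [monomialOp_apply, iteratedLineDerivOp_apply_zero, smulLeftCLM_prod_zero]
    rfl
  · refine ⟨posOp (J 0), h₁ (Sum.inl (J 0)), fun T ψ => ?_⟩
    rw [monomialOp_apply, iteratedLineDerivOp_apply_zero, smulLeftCLM_prod_one]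
  · refine ⟨posOp (J 0) ∘ₗ posOp (J 1), h₂ (Sum.inl (J 0)) (Sum.inl (J 1)), fun T ψ => ?_⟩
    rw [monomialOp_apply, iteratedLineDerivOp_apply_zero, smulLeftCLM_prod_two]
    rfl
  · refine ⟨-derOp (K 0), neg_mem (hder _), fun T ψ => ?_⟩
    rw [monomialOp_apply, iteratedLineDerivOp_apply_one, smulLeftCLM_prod_zero, LinearMap.neg_apply,
      map_neg]
  · refine ⟨-(derOp (K 0) ∘ₗ posOp (J 0)), neg_mem ?_, fun T ψ => ?_⟩
    · rw [derOp_eq_smul_phaseOp, LinearMap.smul_comp]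
      exact Submodule.smul_mem _ _ (h₂ (Sum.inr (K 0)) (Sum.inl (J 0)))
    · rw [monomialOp_apply, iteratedLineDerivOp_apply_one, smulLeftCLM_prod_one,
        LinearMap.neg_apply, map_neg]
      rfl
  · refine ⟨derOp (K 1) ∘ₗ derOp (K 0), ?_, fun T ψ => ?_⟩
    · rw [derOp_eq_smul_phaseOp, derOp_eq_smul_phaseOp, LinearMap.smul_comp, LinearMap.comp_smul]
      exact Submodule.smul_mem _ _ (Submodule.smul_mem _ _ (h₂ (Sum.inr (K 1)) (Sum.inr (K 0))))
    · rw [monomialOp_apply, iteratedLineDerivOp_apply_two, smulLeftCLM_prod_zero]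
      rfl

end Domain

/-! ### Construction of `q^w` on `B` -/

section WeylOperator

variable {n : ℕ}

/-- The reflection `(x, ξ) ↦ (x, -ξ)` of phase space. -/
def phaseRefl (n : ℕ) : RSpace n × RSpace n →ₗ[ℝ] RSpace n × RSpace n :=
  LinearMap.prodMap LinearMap.id (-LinearMap.id)

theorem phaseRefl_apply (X : RSpace n × RSpace n) : phaseRefl n X = (X.1, -X.2) := rfl

/-- The symbol `q (x, -ξ)`, whose quantization is the transpose of that of `q`. -/
noncomputable def transposeSymbol (q : QuadraticMap ℝ (RSpace n × RSpace n) ℂ) :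
    QuadraticMap ℝ (RSpace n × RSpace n) ℂ := q.comp (phaseRefl n)

theorem transposeSymbol_apply (q : QuadraticMap ℝ (RSpace n × RSpace n) ℂ)
    (X : RSpace n × RSpace n) : transposeSymbol q X = q (X.1, -X.2) := rfl

theorem range_transposeSymbol (q : QuadraticMap ℝ (RSpace n × RSpace n) ℂ) :
    Set.range (transposeSymbol q) = Set.range q := by
  ext w
  constructor
  · rintro ⟨X, rfl⟩
    exact ⟨_, (transposeSymbol_apply q X).symm⟩
  · rintro ⟨X, rfl⟩
    exact ⟨(X.1, -X.2), by simp [transposeSymbol_apply]⟩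

theorem IsElliptic.transposeSymbol {q : QuadraticMap ℝ (RSpace n × RSpace n) ℂ}
    (hq : IsElliptic q) : IsElliptic (transposeSymbol q) := by
  intro X hX
  have h := hq _ hX
  rw [phaseRefl_apply, Prod.mk_eq_zero, neg_eq_zero] at h
  exact Prod.ext h.1 h.2

theorem symbolCoeff_transposeSymbol (q : QuadraticMap ℝ (RSpace n × RSpace n) ℂ)
    (a b : Fin n ⊕ Fin n) : symbolCoeff (transposeSymbol q) a b =
      phaseSign a * phaseSign b * symbolCoeff q a b := by
  have h : ∀ a : Fin n ⊕ Fin n, phaseRefl n (phaseBasis a) = phaseSign a • phaseBasis a := by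
    rintro (i | i) <;> simp [phaseRefl_apply, phaseBasis, phaseSign]
  rw [symbolCoeff, transposeSymbol, QuadraticMap.associated_comp, LinearMap.compl₁₂_apply, h, h]
  simp only [map_smul, LinearMap.smul_apply, Complex.real_smul]
  rw [← symbolCoeff]
  ring

/-- Transposition reverses each product `L a L b`, which the symmetry of the coefficients absorbs,
and introduces signs, which the reflection `ξ ↦ -ξ` absorbs. -/
theorem l2Pair_quadOp (q : QuadraticMap ℝ (RSpace n × RSpace n) ℂ) (φ ψ : 𝓢(RSpace n, ℂ)) :
    l2Pair (toL2 φ) (quadOp (symbolCoeff (transposeSymbol q)) phaseOp ψ) =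
      l2Pair (toL2 (quadOp (symbolCoeff q) phaseOp φ)) ψ := by
  rw [quadOp_apply, quadOp_apply]
  simp only [map_sum, map_smul, LinearMap.sum_apply, LinearMap.smul_apply, l2Pair_phaseOp,
    smul_eq_mul]
  rw [Finset.sum_comm]
  refine Finset.sum_congr rfl fun a _ => Finset.sum_congr rfl fun b _ => ?_
  have hs : ∀ a : Fin n ⊕ Fin n, (phaseSign a : ℂ) * phaseSign a = 1 := by
    rintro (i | i) <;> simp [phaseSign]
  rw [symbolCoeff_transposeSymbol, symbolCoeff_symm q b a]
  linear_combination (symbolCoeff q a b * l2Pair (toL2 (phaseOp a (phaseOp b φ))) ψ) *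
    (phaseSign a * phaseSign a * hs b + hs a)

/-- The Weyl quantization of a quadratic form, on the domain `B`. -/
theorem exists_isWeylOperator (q : QuadraticMap ℝ (RSpace n × RSpace n) ℂ) :
    ∃ A : domainB n →ₗ[ℂ] L2 n, IsWeylOperator q A ∧ ∀ u ψ, l2Pair (A u) ψ =
      l2Pair (u : L2 n) (quadOp (symbolCoeff (transposeSymbol q)) phaseOp ψ) := by
  choose A hA using fun u : domainB n =>
    mem_repOps.1 (quadOp_mem_repOps u.2 (symbolCoeff (transposeSymbol q)))
  refine ⟨{ toFun := A, map_add' := fun u v => ?_, map_smul' := fun c u => ?_ }, ⟨?_, ?_⟩, hA⟩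
  · refine l2Pair_injective fun ψ => ?_
    rw [hA, map_add, LinearMap.add_apply, hA, hA]
    simp
  · refine l2Pair_injective fun ψ => ?_
    rw [hA, RingHom.id_apply, map_smul, LinearMap.smul_apply, hA]
    simp
  · intro φ u hu
    have hu' : (u : L2 n) = toL2 φ := by
      refine Lp.ext ?_
      exact hu.trans (coeFn_toL2 φ).symm
    have hAu : A u = toL2 (quadOp (symbolCoeff q) phaseOp φ) := by
      refine l2Pair_injective fun ψ => ?_
      rw [hA, hu', l2Pair_quadOp]
    have hw : weylSchwartz q φ = quadOp (symbolCoeff q) phaseOp φ :=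
      funext (weylSchwartz_eq_quadOp (symbolCoeff_symm q) (apply_eq_quadForm q) φ)
    rw [hw]
    change (A u : RSpace n → ℂ) =ᵐ[volume] _
    rw [hAu]
    exact coeFn_toL2 _
  · intro u φ
    have hw : weylSchwartz (fun X => q (X.1, -X.2)) φ =
        quadOp (symbolCoeff (transposeSymbol q)) phaseOp φ :=
      funext (weylSchwartz_eq_quadOp (symbolCoeff_symm (transposeSymbol q))
        (fun X => by rw [← transposeSymbol_apply, apply_eq_quadForm]) φ)
    rw [hw, ← l2Pair_apply, ← l2Pair_apply]
    exact hA u φ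

end WeylOperator

/-! ### Weak compactness along an ultrafilter -/

section WeakLimit

open Filter Topology

/-- Bounded sequences in a Hilbert space converge weakly along an ultrafilter. -/
theorem exists_weak_limit {H : Type*} [NormedAddCommGroup H] [InnerProductSpace ℂ H]
    [CompleteSpace H] (U : Ultrafilter ℕ) {f : ℕ → H} {C : ℝ} (hC : 0 ≤ C)
    (hf : ∀ N, ‖f N‖ ≤ C) :
    ∃ w : H, ‖w‖ ≤ C ∧ ∀ v, Tendsto (fun N => inner ℂ v (f N)) U (𝓝 (inner ℂ v w)) := by
  -- For each `v` the scalars stay in a compact disc and so converge along `U`; the limits form a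
  -- bounded functional, represented by Riesz.
  have hlim : ∀ v, ∃ c : ℂ, ‖c‖ ≤ C * ‖v‖ ∧ Tendsto (fun N => inner ℂ (f N) v) U (𝓝 c) := by
    intro v
    obtain ⟨c, hc, hle⟩ := (isCompact_closedBall (0 : ℂ) (C * ‖v‖)).ultrafilter_le_nhds
      (U.map fun N => inner ℂ (f N) v) (by
        rw [le_principal_iff]
        refine Ultrafilter.mem_map.2 (univ_mem' fun N => ?_)
        rw [Set.mem_preimage, mem_closedBall_zero_iff]
        exact (norm_inner_le_norm _ _).trans (mul_le_mul_of_nonneg_right (hf N) (norm_nonneg v)))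
    exact ⟨c, mem_closedBall_zero_iff.1 hc, hle⟩
  choose l hl hl' using hlim
  let ℓ : H →ₗ[ℂ] ℂ :=
    { toFun := l
      map_add' := fun v w => tendsto_nhds_unique (hl' (v + w))
        (((hl' v).add (hl' w)).congr fun N => (inner_add_right _ _ _).symm)
      map_smul' := fun c v => tendsto_nhds_unique (hl' (c • v))
        (((hl' v).const_mul c).congr fun N => (inner_smul_right _ _ _).symm) }
  let ℓ' : H →L[ℂ] ℂ := ℓ.mkContinuous C hl
  refine ⟨(InnerProductSpace.toDual ℂ H).symm ℓ', ?_, fun v => ?_⟩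
  · rw [LinearIsometryEquiv.norm_map]
    exact ℓ.mkContinuous_norm_le hC hl
  · have h1 : inner ℂ ((InnerProductSpace.toDual ℂ H).symm ℓ') v = l v :=
      InnerProductSpace.toDual_symm_apply
    rw [← inner_conj_symm, h1]
    refine ((Complex.continuous_conj.tendsto _).comp (hl' v)).congr fun N => ?_
    exact inner_conj_symm _ _

end WeakLimit

/-! ### Solvability and uniqueness -/

section Resolvent

open Filter Topology

variable {n : ℕ}

theorem exists_hermite_galerkin {Q : 𝓢(RSpace n, ℂ) →ₗ[ℂ] 𝓢(RSpace n, ℂ)} {z : ℂ} {d : ℝ}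
    (hd : 0 < d) (hlow : ∀ φ, d * ‖toL2 φ‖ ^ 2 ≤ ‖inner ℂ (toL2 φ) (toL2 (Q φ) - z • toL2 φ)‖)
    (f : L2 n) (N : ℕ) :
    ∃ u ∈ hermiteSpace n N, ∀ v ∈ hermiteSpace n N,
      inner ℂ (toL2 v) (toL2 (Q u) - z • toL2 u - f) = 0 := by
  have hfin := finiteDimensional_hermiteSpace (n := n) N
  let T : 𝓢(RSpace n, ℂ) →ₗ[ℂ] L2 n := toL2 ∘ₗ Q - z • toL2
  have hT : ∀ u, T u = toL2 (Q u) - z • toL2 u := fun _ => rfl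
  obtain ⟨u, hu, h⟩ := exists_galerkin (hermiteSpace n N) toL2_injective T (fun u _ hu => by
    have h := hlow u
    rw [← hT, hu, norm_zero] at h
    have h0 : ‖toL2 u‖ ^ 2 ≤ 0 := nonpos_of_mul_nonpos_right h hd
    have h1 : ‖toL2 u‖ = 0 :=
      (pow_eq_zero_iff two_ne_zero).1 (le_antisymm h0 (sq_nonneg _))
    exact toL2_injective (by rw [norm_eq_zero.1 h1, map_zero])) f
  exact ⟨u, hu, fun v hv => by rw [← hT]; exact h v hv⟩

/-- Approximate solutions of `(q^w - z) u = f` in the span of Hermite functions, with uniform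
bounds. -/
theorem exists_approximate_solution {q : QuadraticMap ℝ (RSpace n × RSpace n) ℂ}
    (hq : IsElliptic q) {z : ℂ} (hz : z ∉ Set.range q) (f : L2 n) :
    ∃ (φ : ℕ → 𝓢(RSpace n, ℂ)) (C : ℝ), 0 ≤ C ∧
      (∀ N, ‖toL2 (φ N)‖ ≤ ‖f‖ / Metric.infDist z (Set.range q)) ∧
      (∀ N a, ‖toL2 (phaseOp a (φ N))‖ ≤ C) ∧
      (∀ N a b, ‖toL2 (phaseOp a (phaseOp b (φ N)))‖ ≤ C) ∧
      ∀ N, ∀ v ∈ hermiteSpace n N, inner ℂ (toL2 v)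
        (toL2 (quadOp (symbolCoeff q) phaseOp (φ N)) - z • toL2 (φ N) - f) = 0 := by
  have hd : 0 < Metric.infDist z (Set.range q) :=
    ((QuadraticMap.isClosed_range_of_elliptic hq).notMem_iff_infDist_pos ⟨_, ⟨0, rfl⟩⟩).1 hz
  set d := Metric.infDist z (Set.range q)
  have hlow : ∀ φ : 𝓢(RSpace n, ℂ), d * ‖toL2 φ‖ ^ 2 ≤
      ‖inner ℂ (toL2 φ) (toL2 (quadOp (symbolCoeff q) phaseOp φ) - z • toL2 φ)‖ :=
    infDist_mul_norm_sq_le phaseOp_symm (symbolCoeff_symm q) (quadForm_mem_range q) z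
  obtain ⟨c, δ, hδ, hcoer⟩ := QuadraticMap.exists_coercive hq
    (fun h => hz (h ▸ Set.mem_univ z))
  have hcoer' : ∀ v, δ / 2 * ∑ a, v a ^ 2 ≤ (c * quadForm (symbolCoeff q) v).re := by
    intro v
    obtain ⟨X, rfl⟩ := phaseCoord_surjective v
    rw [← apply_eq_quadForm]
    refine le_trans ?_ (hcoer X)
    have := mul_le_mul_of_nonneg_left (sum_phaseCoord_sq_le X) (half_pos hδ).le
    linarith
  obtain ⟨C, hC, hest⟩ := exists_elliptic_estimate (j := toL2 (n := n)) phaseOp_symm phaseOp_comm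
    (symbolCoeff_symm q) (half_pos hδ) hcoer' z
  have hgal := exists_hermite_galerkin hd hlow f
  choose φ hφ hgal using hgal
  -- Testing the Galerkin equation with `φ N` itself gives `d ‖φ N‖² ≤ ‖φ N‖ ‖f‖`.
  have hbound : ∀ N, ‖toL2 (φ N)‖ ≤ ‖f‖ / d := by
    intro N
    have h1 := hlow (φ N)
    have h2 := hgal N (φ N) (hφ N)
    rw [inner_sub_right, sub_eq_zero] at h2
    rw [h2] at h1
    have h3 := h1.trans (norm_inner_le_norm _ _)
    rw [le_div_iff₀ hd]
    rcases (norm_nonneg (toL2 (φ N))).eq_or_lt with h0 | h0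
    · rw [← h0, zero_mul]
      exact norm_nonneg f
    · refine le_of_mul_le_mul_right ?_ h0
      linarith
  -- The second test function is `∑ L a ^ 2 (φ N)`, allowed by invariance of the Hermite space.
  have hest' := fun N => hest (φ N) f (hgal N _ (sumSqOp_mem_hermiteSpace (hφ N)))
  have hmono : ∀ N, C * (‖f‖ + ‖toL2 (φ N)‖) ≤ C * (‖f‖ + ‖f‖ / d) := fun N =>
    mul_le_mul_of_nonneg_left (add_le_add_right (hbound N) _) hC
  exact ⟨φ, C * (‖f‖ + ‖f‖ / d), by positivity, hbound,
    fun N a => ((hest' N).1 a).trans (hmono N),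
    fun N a b => ((hest' N).2 a b).trans (hmono N), hgal⟩

/-- The approximate solutions solve the equation in the weak limit. -/
theorem tendsto_inner_approximate_solution {m : Fin n ⊕ Fin n → Fin n ⊕ Fin n → ℂ} {z : ℂ}
    {f : L2 n} {φ : ℕ → 𝓢(RSpace n, ℂ)} {C C' : ℝ} (hC : 0 ≤ C)
    (h₀ : ∀ N, ‖toL2 (φ N)‖ ≤ C') (h₂ : ∀ N a b, ‖toL2 (phaseOp a (phaseOp b (φ N)))‖ ≤ C)
    (hgal : ∀ N, ∀ v ∈ hermiteSpace n N, inner ℂ (toL2 v)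
      (toL2 (quadOp m phaseOp (φ N)) - z • toL2 (φ N) - f) = 0)
    (U : Ultrafilter ℕ) (hU : (U : Filter ℕ) ≤ atTop) (v : L2 n) :
    Tendsto (fun N => inner ℂ v (toL2 (quadOp m phaseOp (φ N)) - z • toL2 (φ N))) U
      (𝓝 (inner ℂ v f)) := by
  have hC' : 0 ≤ C' := (norm_nonneg _).trans (h₀ 0)
  have hbound : ∀ N, ‖toL2 (quadOp m phaseOp (φ N)) - z • toL2 (φ N)‖ ≤
      (∑ a, ∑ b, ‖m a b‖ * C) + ‖z‖ * C' := by
    intro N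
    refine (norm_sub_le _ _).trans (add_le_add ?_ ?_)
    · rw [quadOp_apply, map_sum]
      refine (norm_sum_le _ _).trans (Finset.sum_le_sum fun a _ => ?_)
      rw [map_sum]
      refine (norm_sum_le _ _).trans (Finset.sum_le_sum fun b _ => ?_)
      rw [map_smul, norm_smul]
      exact mul_le_mul_of_nonneg_left (h₂ N a b) (norm_nonneg _)
    · rw [norm_smul]
      exact mul_le_mul_of_nonneg_left (h₀ N) (norm_nonneg _)
  -- Each Hermite function is a test function for all large `N`, so `w - f` is orthogonal to a total
  -- set.
  obtain ⟨w, -, hw⟩ := exists_weak_limit U (by positivity) hbound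
  suffices h : w - f = 0 by
    rw [sub_eq_zero] at h
    exact h ▸ hw v
  refine eq_zero_of_inner_hermiteSpace_eq_zero _ fun N ψ hψ => ?_
  rw [inner_sub_right, sub_eq_zero]
  refine tendsto_nhds_unique (hw (toL2 ψ)) (tendsto_const_nhds.congr' ?_)
  filter_upwards [hU (eventually_ge_atTop N)] with M hM
  have h := hgal M ψ (hermiteSpace_mono hM hψ)
  rw [inner_sub_right, sub_eq_zero] at h
  exact h.symm

/-- Weak limits of Schwartz functions that are bounded together with their images under an
operator. -/
theorem mem_repOps_of_weak_limit {U : Ultrafilter ℕ} {φ : ℕ → 𝓢(RSpace n, ℂ)} {u : L2 n}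
    (hu : ∀ v, Tendsto (fun N => inner ℂ v (toL2 (φ N))) U (𝓝 (inner ℂ v u)))
    {M M' : 𝓢(RSpace n, ℂ) →ₗ[ℂ] 𝓢(RSpace n, ℂ)} {s : ℂ}
    (hM : ∀ φ ψ, l2Pair (toL2 φ) (M ψ) = s * l2Pair (toL2 (M' φ)) ψ) {C : ℝ} (hC : 0 ≤ C)
    (hbound : ∀ N, ‖toL2 (M' (φ N))‖ ≤ C) : M ∈ repOps u := by
  obtain ⟨w, -, hw⟩ := exists_weak_limit U hC hbound
  refine ⟨s • w, fun ψ => ?_⟩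
  rw [map_smul, LinearMap.smul_apply, smul_eq_mul, l2Pair_eq_inner_star_toL2,
    l2Pair_eq_inner_star_toL2]
  refine tendsto_nhds_unique ((hw (star (toL2 ψ))).const_mul s) ?_
  refine (hu (star (toL2 (M ψ)))).congr fun N => ?_
  rw [← l2Pair_eq_inner_star_toL2, ← l2Pair_eq_inner_star_toL2, hM]

theorem exists_solution {q : QuadraticMap ℝ (RSpace n × RSpace n) ℂ} (hq : IsElliptic q)
    {A : domainB n →ₗ[ℂ] L2 n} (hA : ∀ u ψ, l2Pair (A u) ψ =
      l2Pair (u : L2 n) (quadOp (symbolCoeff (transposeSymbol q)) phaseOp ψ))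
    {z : ℂ} (hz : z ∉ Set.range q) (f : L2 n) :
    ∃ u : domainB n, A u - z • (u : L2 n) = f ∧
      ‖(u : L2 n)‖ ≤ ‖f‖ / Metric.infDist z (Set.range q) := by
  obtain ⟨φ, C, hC, h₀, h₁, h₂, hgal⟩ := exists_approximate_solution hq hz f
  have hlim := tendsto_inner_approximate_solution hC h₀ h₂ hgal (hyperfilter ℕ)
    Nat.hyperfilter_le_atTop
  obtain ⟨u, hunorm, hu⟩ := exists_weak_limit (hyperfilter ℕ) ((norm_nonneg _).trans (h₀ 0)) h₀
  have humem : u ∈ domainB n := by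
    refine mem_domainB_of_mem_repOps (fun a => ?_) fun a b => ?_
    · exact mem_repOps_of_weak_limit hu (l2Pair_phaseOp a) hC fun N => h₁ N a
    · refine mem_repOps_of_weak_limit hu (M' := phaseOp b ∘ₗ phaseOp a)
        (s := phaseSign a * phaseSign b) (fun φ ψ => ?_) hC fun N => h₂ N b a
      rw [LinearMap.comp_apply, l2Pair_phaseOp, l2Pair_phaseOp, mul_assoc]
      rfl
  refine ⟨⟨u, humem⟩, l2Pair_injective fun ψ => ?_, hunorm⟩
  rw [map_sub, LinearMap.sub_apply, hA, map_smul, LinearMap.smul_apply, ← map_smul, ← map_sub,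
    l2Pair_eq_inner_star_toL2, l2Pair_eq_inner_star_toL2]
  refine tendsto_nhds_unique (hu _) ((hlim (star (toL2 ψ))).congr fun N => ?_)
  rw [← l2Pair_eq_inner_star_toL2, ← l2Pair_eq_inner_star_toL2, map_sub, map_sub,
    LinearMap.sub_apply, l2Pair_quadOp, map_smul, map_smul, LinearMap.smul_apply]

/-- Let `φ N` be approximate solutions of the transposed equation with right-hand side the conjugate
of `u`. Pairing that equation with `u` gives `0` for every `N`, since the operator moves back onto
`u`, while the weak limit is `‖u‖²`. -/
theorem eq_zero_of_apply_eq_smul {q : QuadraticMap ℝ (RSpace n × RSpace n) ℂ} (hq : IsElliptic q)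
    {A : domainB n →ₗ[ℂ] L2 n} (hA : ∀ u ψ, l2Pair (A u) ψ =
      l2Pair (u : L2 n) (quadOp (symbolCoeff (transposeSymbol q)) phaseOp ψ))
    {z : ℂ} (hz : z ∉ Set.range q) {u : domainB n} (hu : A u - z • (u : L2 n) = 0) : u = 0 := by
  rw [← range_transposeSymbol] at hz
  obtain ⟨φ, C, hC, h₀, -, h₂, hgal⟩ :=
    exists_approximate_solution hq.transposeSymbol hz (star (u : L2 n))
  have hlim := tendsto_inner_approximate_solution hC h₀ h₂ hgal (hyperfilter ℕ)
    Nat.hyperfilter_le_atTop (star (u : L2 n))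
  have hzero : ∀ N, inner ℂ (star (u : L2 n))
      (toL2 (quadOp (symbolCoeff (transposeSymbol q)) phaseOp (φ N)) - z • toL2 (φ N)) = 0 := by
    intro N
    rw [← map_smul, ← map_sub, ← l2Pair_eq_inner_star, map_sub, ← hA, map_smul, ← LinearMap.smul_apply,
      ← map_smul, ← LinearMap.sub_apply, ← map_sub, hu]
    simp
  simp only [hzero] at hlim
  have h0 : star (u : L2 n) = 0 :=
    inner_self_eq_zero.1 (tendsto_nhds_unique tendsto_const_nhds hlim).symm
  have h1 : (u : L2 n) = 0 := by
    refine l2Pair_injective fun ψ => ?_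
    rw [l2Pair_eq_inner_star, h0]
    simp
  exact Subtype.ext h1

end Resolvent

/-! ### The resolvent and its norm bound -/

theorem proposition2p2p1 (n : ℕ) (hn : 0 < n)
    (q : QuadraticMap ℝ (RSpace n × RSpace n) ℂ) (hq : IsElliptic q) :
    ∃ A : domainB n →ₗ[ℂ] L2 n, IsWeylOperator q A ∧
      ∀ z : ℂ, z ∉ numRange q →
        ∃ R : L2 n →L[ℂ] L2 n, IsResolventAt A z R ∧
          ‖R‖ ≤ 1 / Metric.infDist z (numRange q) := by
  obtain ⟨A, hweyl, hA⟩ := exists_isWeylOperator q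
  refine ⟨A, hweyl, fun z hz => ?_⟩
  let T : domainB n →ₗ[ℂ] L2 n := A - z • (domainB n).subtype
  have hT : Function.Bijective T := by
    constructor
    · rw [← LinearMap.ker_eq_bot, LinearMap.ker_eq_bot']
      exact fun u hu => eq_zero_of_apply_eq_smul hq hA hz hu
    · intro f
      obtain ⟨u, hu, -⟩ := exists_solution hq hA hz f
      exact ⟨u, hu⟩
  let e := LinearEquiv.ofBijective T hT
  have hbound : ∀ f, ‖((domainB n).subtype ∘ₗ e.symm.toLinearMap) f‖ ≤
      1 / Metric.infDist z (numRange q) * ‖f‖ := by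
    intro f
    -- By injectivity the constructed solution is the inverse image of `f`, so its norm bound passes
    -- to the inverse.
    obtain ⟨u, hu, hnorm⟩ := exists_solution hq hA hz f
    have hef : e.symm f = u := by
      rw [LinearEquiv.symm_apply_eq]
      exact hu.symm
    change ‖((e.symm f : domainB n) : L2 n)‖ ≤ _
    rw [hef, one_div_mul_eq_div]
    exact hnorm
  refine ⟨LinearMap.mkContinuous _ _ hbound, ⟨fun u => ?_, fun f => ?_⟩,
    LinearMap.mkContinuous_norm_le _ (one_div_nonneg.2 Metric.infDist_nonneg) hbound⟩
  · change ((e.symm (e u) : domainB n) : L2 n) = u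
    rw [LinearEquiv.symm_apply_apply]
  · exact ⟨(e.symm f).2, e.apply_symm_apply f⟩
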